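/- A trigonometric polynomial is a function $\mu(\mathbf r)=\sum_{\mathbf k\in\mathbb Z^2}c[\mathbf k]\,e^{j2\pi\langle \mathbf k,\mathbf r\rangle}$ with finitely many non-zero coefficients $c[\mathbf k]\in\mathbb C$; its degree is the pair of dimensions (numbers of integer points along each side) of the smallest rectangle containing the support of $c$, and degrees are compared componentwise. We say $\mu$ divides $\nu$ if $\nu=\mu\gamma$ for some trigonometric polynomial $\gamma$. A trigonometric polynomial $\mu$ is a minimal polynomial for $C\subset[0,1]^2$ if $C=\{\mathbf r\in[0,1]^2:\mu(\mathbf r)=0\}$ and, for every trigonometric polynomial $\nu$ with $C=\{\mathbf r\in[0,1]^2:\nu(\mathbf r)=0\}$, we have $\deg\mu\le\deg\nu$ and $\mu$ divides $\nu$. For integers $K,L\ge 0$ let $\Lambda=\{(k,l)\in\mathbb Z^2:|k|\le K,\ |l|\le L\}$ and $m\Lambda=\{(k,l)\in\mathbb Z^2:|k|\le mK,\ |l|\le mL\}$. Theorem. Let $\Omega\subset[0,1]^2$ be a simply connected region (a non-empty open simply connected subset of $\mathbb R^2$) whose topological boundary $\partial\Omega$ has a minimal polynomial $\mu$ with coefficients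 $c[\mathbf k]$, $\mathbf k\in\Lambda$, where $\Lambda$ is the smallest rectangle containing the support of $c$, i.e. $\deg\mu=(2K+1,2L+1)$. Let $f=\chi_\Omega$, let $f_x,f_y$ be its distributional partial derivatives, and for $u\in\{f_x,f_y\}$ let $\widehat u(\boldsymbol\omega)=\langle u,e^{-j\langle\boldsymbol\omega,\cdot\rangle}\rangle$ denote the Fourier transform. Then $c$ is the unique non-trivial solution, up to scaling, of the annihilation equations: $c\neq 0$ satisfies $$\sum_{\mathbf k\in\Lambda}c[\mathbf k]\,\widehat{f_x}(2\pi[\mathbf l-\mathbf k])=0,\qquad \sum_{\mathbf k\in\Lambda}c[\mathbf k]\,\widehat{f_y}(2\pi[\mathbf l-\mathbf k])=0\qquad\text{for all }\mathbf l\in2\Lambda,$$ and every non-zero $d=(d[\mathbf k])_{\mathbf k\in\Lambda}$ satisfying the same equations (with $d$ in place of $c$) is of the form $d=a\,c$ with $a\in\mathbb C\setminus\{0\}$. These equations use exactly the Fourier samples of $f$ on $2\pi\cdot3\Lambda$: one has $\{\mathbf l-\mathbf k:\mathbf l\in2\Lambda,\ \mathbf k\in\Lambda\}=3\Lambda$,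 and $\widehat{f_x}(\boldsymbol\omega)=j\omega_x\widehat f(\boldsymbol\omega)$, $\widehat{f_y}(\boldsymbol\omega)=j\omega_y\widehat f(\boldsymbol\omega)$ for $\boldsymbol\omega=2\pi\mathbf m$, $\mathbf m\in3\Lambda$, where $\widehat f(\boldsymbol\omega)=\int f(\mathbf r)e^{-j\langle\boldsymbol\omega,\mathbf r\rangle}\,d\mathbf r$. -/

import Mathlib

open MeasureTheory
open scoped Pointwise

noncomputable section

/-- The value at `r ∈ ℝ²` of the trigonometric polynomial `∑ₖ c[k] exp(j 2π ⟨k, r⟩)`, which is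
represented by its finitely supported family of coefficients `c`. -/
def trigEval (c : ℤ × ℤ →₀ ℂ) (r : ℝ × ℝ) : ℂ :=
  ∑ k ∈ c.support,
    c k * Complex.exp (2 * Real.pi * Complex.I * ((k.1 : ℂ) * (r.1 : ℂ) + (k.2 : ℂ) * (r.2 : ℂ)))

/-- The trigonometric curve of `c`: its zero set in the unit square `[0,1]²`. -/
def trigCurve (c : ℤ × ℤ →₀ ℂ) : Set (ℝ × ℝ) :=
  {r | r ∈ Set.Icc (0 : ℝ × ℝ) 1 ∧ trigEval c r = 0}

/-- `a` divides `b` among trigonometric polynomials: `b = a · γ` for a trigonometric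
polynomial `γ`. -/
def TrigDvd (a b : ℤ × ℤ →₀ ℂ) : Prop :=
  ∃ g : ℤ × ℤ →₀ ℂ, ∀ r : ℝ × ℝ, trigEval b r = trigEval a r * trigEval g r

/-- The degree of a trigonometric polynomial: the dimensions (numbers of integer points along
the two sides) of the smallest rectangle that contains its frequency support. -/
def trigDegree (c : ℤ × ℤ →₀ ℂ) : ℕ × ℕ :=
  (sInf {n : ℕ | ∃ a : ℤ, ∀ k ∈ c.support, a ≤ k.1 ∧ k.1 < a + n},
   sInf {n : ℕ | ∃ a : ℤ, ∀ k ∈ c.support, a ≤ k.2 ∧ k.2 < a + n})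

/-- `c` is a minimal polynomial for `C ⊆ [0,1]²`: its zero set is `C`, and it divides, and has
degree at most that of (componentwise), every trigonometric polynomial with zero set `C`. -/
def IsMinimalTrigPoly (c : ℤ × ℤ →₀ ℂ) (C : Set (ℝ × ℝ)) : Prop :=
  trigCurve c = C ∧
    ∀ b : ℤ × ℤ →₀ ℂ, trigCurve b = C → trigDegree c ≤ trigDegree b ∧ TrigDvd c b

/-- The frequency rectangle `{(k, l) : |k| ≤ K, |l| ≤ L}`, of dimensions
`(2 * K + 1, 2 * L + 1)`. -/
def freqBox (K L : ℕ) : Finset (ℤ × ℤ) :=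
  Finset.Icc (-(K : ℤ)) K ×ˢ Finset.Icc (-(L : ℤ)) L

/-- The characteristic function of `Ω`. -/
def charFn (Ω : Set (ℝ × ℝ)) : ℝ × ℝ → ℂ :=
  Ω.indicator fun _ => 1

/-- The exponential `r ↦ exp(-j ⟨ω, r⟩)`. -/
def expNeg (ω r : ℝ × ℝ) : ℂ :=
  Complex.exp (-(Complex.I * ((ω.1 : ℂ) * (r.1 : ℂ) + (ω.2 : ℂ) * (r.2 : ℂ))))

/-- The Fourier transform `f̂(ω) = ∫ f(r) exp(-j ⟨ω, r⟩) dr`. -/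
def fourierHat (f : ℝ × ℝ → ℂ) (ω : ℝ × ℝ) : ℂ :=
  ∫ r, f r * expNeg ω r

/-- The distributional derivative of `f` in the direction `v`, paired with `φ`:
`⟨∂ᵥ f, φ⟩ = -∫ f ∂ᵥφ`. For `f` integrable with bounded support this makes sense for every
smooth `φ`. -/
def distDeriv (f : ℝ × ℝ → ℂ) (v : ℝ × ℝ) (φ : ℝ × ℝ → ℂ) : ℂ :=
  -∫ r, f r * lineDeriv ℝ φ r v

/-- The Fourier transform of the distributional derivative `f_x = ∂f/∂x`, that is, the compactly
supported distribution `f_x` paired with `exp(-j ⟨ω, ·⟩)`. -/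
def fourierHatDx (f : ℝ × ℝ → ℂ) (ω : ℝ × ℝ) : ℂ :=
  distDeriv f (1, 0) (expNeg ω)

/-- The Fourier transform of the distributional derivative `f_y = ∂f/∂y`. -/
def fourierHatDy (f : ℝ × ℝ → ℂ) (ω : ℝ × ℝ) : ℂ :=
  distDeriv f (0, 1) (expNeg ω)

/-- The frequency `2π m`. -/
def freq (m : ℤ × ℤ) : ℝ × ℝ :=
  (2 * Real.pi * (m.1 : ℝ), 2 * Real.pi * (m.2 : ℝ))

/-- The annihilation equations for the filter `d` supported in `Λ`, tested at `l ∈ Γ`. -/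
def Annihilates (f : ℝ × ℝ → ℂ) (Λ Γ : Finset (ℤ × ℤ)) (d : ℤ × ℤ →₀ ℂ) : Prop :=
  ∀ l ∈ Γ,
    ∑ k ∈ Λ, d k * fourierHatDx f (freq (l - k)) = 0 ∧
    ∑ k ∈ Λ, d k * fourierHatDy f (freq (l - k)) = 0

end

/-! Write μ for the trigonometric polynomial of `c` and ν for that of a solution `d`. By linearity
the annihilation equations say that ∫_Ω ∂ᵥ(ν e^{-j2π⟨l,r⟩}) = 0 for both coordinate directions v and
all l ∈ 2Λ (`annihilates_charFn_iff`). For ν = μ this is the divergence theorem for a function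
vanishing on ∂Ω; slicing and a one-dimensional argument prove it without any regularity of ∂Ω
(`setIntegral_fderiv_fst_eq_zero_of_frontier`).

For uniqueness, combine the equations into the test function ν̄ ∂ᵥμ, whose frequencies lie in 2Λ:
this gives ∫_Ω ∂ᵥ(|ν|² ∂ᵥμ) = 0. By minimality the conjugate of μ is a multiple of μ, so a rescaling
m of μ is real, and m > 0 on the connected set Ω. Formally the integral is now, up to sign, the
integral over ∂Ω of |ν|² (∂ᵥm)² / |∇m|, so ν ∂ᵥμ = 0 on ∂Ω. The rigorous version replaces the
boundary integral by an exponential boundary layer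
(`eq_zero_of_setIntegral_fderiv_mul_fderiv_eq_zero`).

The rest is algebra. Multiplication by a monomial turns μ and ν into bivariate polynomials P and D.
Minimality makes every prime factor of P indispensable for the zero set, so P is squarefree
(`IsMinimalTrigPoly.not_dvd_of_mul_eq`). Let P = p q with p prime and suppose that p does not divide
D. Where p = 0 and ∂ᵥμ = 0, the product of q with a partial derivative of p vanishes, so all points
of ∂Ω with p = 0 are common zeros of p and a polynomial prime to it: there are finitely many. As Ω
is simply connected, ∂Ω has no isolated points (`IsSimplyConnected.frequently_mem_frontier`), so q
vanishes on all of ∂Ω and p was dispensable, a contradiction. Hence P divides D, and since both fit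
in the same box, which P fills, the quotient is constant. -/

/-! ### Divergence theorem on an arbitrary bounded open set -/

/-- The extension of `h` from `U` by zero is continuous, and differentiable with the expected
derivative except at simple zeros of `h`. These are countably many, so the fundamental theorem of
calculus with a countable exceptional set applies on an interval containing `U`. -/
theorem setIntegral_deriv_eq_zero_of_frontier {E : Type*} [NormedAddCommGroup E] [NormedSpace ℝ E]
    [CompleteSpace E] {U : Set ℝ} (hU : IsOpen U) (hb : Bornology.IsBounded U) {h h' : ℝ → E}
    (hd : ∀ x, HasDerivAt h (h' x) x) (hc : Continuous h') (h0 : ∀ x ∈ frontier U, h x = 0) :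
    ∫ x in U, h' x = 0 := by
  classical
  obtain ⟨R, hR⟩ := hb.subset_ball 0
  have hsub : U ⊆ Set.Ioo (-R) R := by simpa [Real.ball_eq_Ioo] using hR
  rcases U.eq_empty_or_nonempty with rfl | ⟨u, hu⟩
  · simp
  have hlt : -R < R := (hsub hu).1.trans (hsub hu).2
  have hout : ∀ x ∉ U, x ∉ frontier U → U.indicator h =ᶠ[nhds x] fun _ => 0 := by
    intro x hx hxf
    have hxc : x ∉ closure U := fun hxc => hxf ⟨hxc, by rwa [hU.interior_eq]⟩
    filter_upwards [isClosed_closure.isOpen_compl.mem_nhds hxc] with y hy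
    exact Set.indicator_of_notMem (fun hyU => hy (subset_closure hyU)) _
  -- A zero with non-zero derivative is isolated from the right in the zero set, and a set of reals
  -- has only countably many such points.
  have hcount : {x : ℝ | h x = 0 ∧ h' x ≠ 0}.Countable := by
    refine (countable_setOfPred_isolated_right_within (s := {x : ℝ | h x = 0})).mono ?_
    rintro x ⟨hx, hx'⟩
    refine ⟨hx, ?_⟩
    have h1 := (hd x).eventually_ne (c := 0) hx'
    have h2 : ∀ᶠ z in nhdsWithin x (Set.Ioi x), h z ≠ 0 :=
      h1.filter_mono (nhdsWithin_mono _ fun y hy => ne_of_gt hy)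
    rw [Set.inter_comm, ← Filter.empty_mem_iff_bot, mem_nhdsWithin_iff_eventually]
    filter_upwards [eventually_nhdsWithin_iff.1 h2] with y hy hy'
    exact hy hy'.1 hy'.2
  have hcont : Continuous (U.indicator h) :=
    continuous_indicator h0 (continuous_iff_continuousAt.2 fun x => (hd x).continuousAt).continuousOn
  have hder : ∀ x ∈ Set.Ioo (-R) R \ {x : ℝ | h x = 0 ∧ h' x ≠ 0},
      HasDerivAt (U.indicator h) (U.indicator h' x) x := by
    rintro x ⟨-, hx⟩
    by_cases hxU : x ∈ U
    · rw [Set.indicator_of_mem hxU]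
      refine (hd x).congr_of_eventuallyEq ?_
      filter_upwards [hU.mem_nhds hxU] with y hy using Set.indicator_of_mem hy _
    · rw [Set.indicator_of_notMem hxU]
      by_cases hxf : x ∈ frontier U
      · have hx0 := h0 x hxf
        have hx' : h' x = 0 := by
          by_contra hne
          exact hx ⟨hx0, hne⟩
        have hdx := hd x
        rw [hx', hasDerivAt_iff_isLittleO] at hdx
        rw [hasDerivAt_iff_isLittleO]
        simp only [hx0, sub_zero, smul_zero, Set.indicator_of_notMem hxU] at hdx ⊢
        -- At a double zero, `h` is already o(y - x), and the indicator is dominated by it.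
        refine Asymptotics.IsBigO.trans_isLittleO ?_ hdx
        exact Asymptotics.isBigO_of_le _ fun y => norm_indicator_le_norm_self _ _
      · exact (hasDerivAt_const x (0 : E)).congr_of_eventuallyEq (hout x hxU hxf)
  have hint : IntervalIntegrable (U.indicator h') volume (-R) R := by
    rw [intervalIntegrable_iff_integrableOn_Ioc_of_le hlt.le]
    exact ((hc.integrableOn_Icc (a := -R) (b := R)).mono_set Set.Ioc_subset_Icc_self).indicator
      hU.measurableSet
  have key := integral_eq_of_hasDerivAt_off_countable_of_le (U.indicator h) (U.indicator h')
    hlt.le hcount hcont.continuousOn hder hint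
  have e1 : U.indicator h R = 0 := Set.indicator_of_notMem (fun hh => lt_irrefl _ (hsub hh).2) _
  have e2 : U.indicator h (-R) = 0 := Set.indicator_of_notMem (fun hh => lt_irrefl _ (hsub hh).1) _
  rw [e1, e2, sub_zero, intervalIntegral.integral_of_le hlt.le,
    setIntegral_indicator hU.measurableSet] at key
  rwa [Set.inter_eq_self_of_subset_right (hsub.trans Set.Ioo_subset_Ioc_self)] at key

theorem Continuous.integrableOn_of_isBounded {X E : Type*} [MetricSpace X] [ProperSpace X]
    [MeasurableSpace X] [OpensMeasurableSpace X] [NormedAddCommGroup E] {μ : Measure X}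
    [IsFiniteMeasureOnCompacts μ] {f : X → E} (hf : Continuous f)
    {s : Set X} (hs : Bornology.IsBounded s) : IntegrableOn f s μ :=
  (hf.continuousOn.integrableOn_compact hs.isCompact_closure).mono_set subset_closure

/-- Fubini reduces this to horizontal slices: the frontier of a slice of `Ω` lies in the slice of
the frontier. -/
theorem setIntegral_fderiv_fst_eq_zero_of_frontier {E : Type*} [NormedAddCommGroup E]
    [NormedSpace ℝ E] [CompleteSpace E] {Ω : Set (ℝ × ℝ)} (hΩ : IsOpen Ω)
    (hb : Bornology.IsBounded Ω) {φ : ℝ × ℝ → E} (hφ : ContDiff ℝ 1 φ)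
    (h0 : ∀ r ∈ frontier Ω, φ r = 0) :
    ∫ r in Ω, fderiv ℝ φ r (1, 0) = 0 := by
  have hcont : Continuous fun r => fderiv ℝ φ r (1, 0) :=
    (hφ.continuous_fderiv (by norm_num)).clm_apply continuous_const
  rw [← integral_indicator hΩ.measurableSet, Measure.volume_eq_prod, integral_prod_symm]
  · have : ∀ y : ℝ, ∫ x : ℝ, Ω.indicator (fun r => fderiv ℝ φ r (1, 0)) (x, y) = 0 := by
      intro y
      have hcy : Continuous fun x : ℝ => (x, y) := by fun_prop
      have hU := hΩ.preimage hcy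
      rw [← setIntegral_deriv_eq_zero_of_frontier (h := fun x => φ (x, y))
        (h' := fun x => fderiv ℝ φ (x, y) (1, 0)) hU _ _ (hcont.comp hcy),
        ← integral_indicator hU.measurableSet]
      · rfl
      · intro x hx
        exact h0 _ (hcy.frontier_preimage_subset Ω hx)
      · refine (hb.image_fst).subset ?_
        intro x hx
        exact ⟨(x, y), hx, rfl⟩
      · intro x
        have h1 := ((hφ.differentiable (by norm_num)) (x, y)).hasFDerivAt
        exact h1.comp_hasDerivAt x ((hasDerivAt_id x).prodMk (hasDerivAt_const x y))
    simp [this]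
  · rw [← Measure.volume_eq_prod]
    exact (hcont.integrableOn_of_isBounded hb).integrable_indicator hΩ.measurableSet

/-! ### Flux of a positive function through the boundary -/

theorem IsPreconnected.subset_of_disjoint_frontier {X : Type*} [TopologicalSpace X] {S Ω : Set X}
    (hS : IsPreconnected S) (hΩ : IsOpen Ω) (hne : (S ∩ Ω).Nonempty)
    (hd : ∀ r ∈ S, r ∉ frontier Ω) : S ⊆ Ω := by
  refine hS.subset_left_of_subset_union hΩ isClosed_closure.isOpen_compl
    (Set.disjoint_compl_right_iff_subset.2 subset_closure) ?_ hne
  intro r hr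
  by_cases h : r ∈ Ω
  · exact Or.inl h
  · refine Or.inr fun hc => hd r hr ⟨hc, by rwa [hΩ.interior_eq]⟩

theorem ContDiff.hasDerivAt_slice_fst {E : Type*} [NormedAddCommGroup E] [NormedSpace ℝ E]
    {m : ℝ × ℝ → E} (hm : ContDiff ℝ 1 m) (x y : ℝ) :
    HasDerivAt (fun x => m (x, y)) (fderiv ℝ m (x, y) (1, 0)) x :=
  ((hm.differentiable (by norm_num)) (x, y)).hasFDerivAt.comp_hasDerivAt x
    ((hasDerivAt_id x).prodMk (hasDerivAt_const x y))

/-- Near a frontier point at which `m` increases horizontally, the part of `Ω` where `m < ε` has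
measure at least proportional to `ε`. -/
theorem exists_mul_le_volume_sublevel {Ω : Set (ℝ × ℝ)} (hΩ : IsOpen Ω) {m : ℝ × ℝ → ℝ}
    (hm : ContDiff ℝ 1 m) (hpos : ∀ r ∈ Ω, 0 < m r) (h0 : ∀ r ∈ frontier Ω, m r = 0)
    {r₀ : ℝ × ℝ} (hr₀ : r₀ ∈ frontier Ω) (hx : 0 < fderiv ℝ m r₀ (1, 0))
    {U : Set (ℝ × ℝ)} (hU : IsOpen U) (hr₀U : r₀ ∈ U) :
    ∃ κ > 0, ∃ ε₀ > 0, ∀ ε, 0 < ε → ε ≤ ε₀ →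
      ENNReal.ofReal (κ * ε) ≤ volume (U ∩ Ω ∩ {r | m r < ε}) := by
  obtain ⟨x₀, y₀⟩ := r₀
  have hcont : Continuous fun r => fderiv ℝ m r (1, 0) :=
    (hm.continuous_fderiv (by norm_num)).clm_apply continuous_const
  set M : ℝ := fderiv ℝ m (x₀, y₀) (1, 0) + 1 with hM
  have hMpos : 0 < M := by linarith
  have hV : U ∩ {r | 0 < fderiv ℝ m r (1, 0)} ∩ {r | fderiv ℝ m r (1, 0) < M}
      ∈ nhds (x₀, y₀) :=
    Filter.inter_mem (Filter.inter_mem (hU.mem_nhds hr₀U)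
      ((isOpen_lt continuous_const hcont).mem_nhds hx))
      ((isOpen_lt hcont continuous_const).mem_nhds (by simp [hM]))
  obtain ⟨a, ha, hball⟩ := Metric.nhds_basis_closedBall.mem_iff.1 hV
  rw [← closedBall_prod_same, Real.closedBall_eq_Icc, Real.closedBall_eq_Icc] at hball
  have hder := hm.hasDerivAt_slice_fst
  have hmono : ∀ y ∈ Set.Icc (y₀ - a) (y₀ + a),
      StrictMonoOn (fun x => m (x, y)) (Set.Icc (x₀ - a) (x₀ + a)) := by
    intro y hy
    refine strictMonoOn_of_deriv_pos (convex_Icc _ _)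
      (fun x _ => (hder x y).continuousAt.continuousWithinAt) fun x hx => ?_
    rw [(hder x y).deriv]
    exact (hball ⟨interior_subset hx, hy⟩).1.2
  have hlip : ∀ y ∈ Set.Icc (y₀ - a) (y₀ + a), ∀ x ∈ Set.Icc (x₀ - a) (x₀ + a),
      ∀ x' ∈ Set.Icc (x₀ - a) (x₀ + a), x ≤ x' → m (x', y) - m (x, y) ≤ M * (x' - x) := by
    intro y hy
    refine (convex_Icc _ _).image_sub_le_mul_sub_of_deriv_le (f := fun x => m (x, y))
      (fun x _ => (hder x y).continuousAt.continuousWithinAt)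
      (fun x _ => (hder x y).differentiableAt.differentiableWithinAt) fun x hx => ?_
    rw [(hder x y).deriv]
    exact (hball ⟨interior_subset hx, hy⟩).2.le
  have hy₀ : y₀ ∈ Set.Icc (y₀ - a) (y₀ + a) := ⟨by linarith, by linarith⟩
  have hxl : x₀ - a ∈ Set.Icc (x₀ - a) (x₀ + a) := ⟨le_rfl, by linarith⟩
  have hxr : x₀ + a ∈ Set.Icc (x₀ - a) (x₀ + a) := ⟨by linarith, le_rfl⟩
  have hxm : x₀ ∈ Set.Icc (x₀ - a) (x₀ + a) := ⟨by linarith, by linarith⟩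
  have hm0 : m (x₀, y₀) = 0 := h0 _ hr₀
  have hneg : m (x₀ - a, y₀) < 0 := by
    have := hmono y₀ hy₀ hxl hxm (by linarith); simpa [hm0] using this
  have hposr : 0 < m (x₀ + a, y₀) := by
    have := hmono y₀ hy₀ hxm hxr (by linarith); simpa [hm0] using this
  set ε₀ := m (x₀ + a, y₀) / 2 with hε₀
  have hε₀pos : 0 < ε₀ := by positivity
  have hW : {y | m (x₀ - a, y) < 0} ∩ {y | ε₀ < m (x₀ + a, y)} ∩ Metric.closedBall y₀ a
      ∈ nhds y₀ := by
    have c1 : Continuous fun y => m (x₀ - a, y) := hm.continuous.comp (by fun_prop)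
    have c2 : Continuous fun y => m (x₀ + a, y) := hm.continuous.comp (by fun_prop)
    exact Filter.inter_mem (Filter.inter_mem ((isOpen_lt c1 continuous_const).mem_nhds hneg)
      ((isOpen_lt continuous_const c2).mem_nhds (by simp only [Set.mem_ofPred_eq]; linarith)))
      (Metric.closedBall_mem_nhds _ ha)
  obtain ⟨b, hb, hbW⟩ := Metric.nhds_basis_closedBall.mem_iff.1 hW
  rw [Real.closedBall_eq_Icc, Real.closedBall_eq_Icc] at hbW
  have hlift : ∀ S : Set (ℝ × ℝ), IsPreconnected S → (S ∩ Ω).Nonempty → (∀ r ∈ S, 0 < m r) →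
      S ⊆ Ω := fun S hS hne hp =>
    hS.subset_of_disjoint_frontier hΩ hne fun r hr hf => (hp r hr).ne' (h0 r hf)
  have hslice : ∀ y ∈ Set.Icc (y₀ - b) (y₀ + b), ∀ x ∈ Set.Icc (x₀ - a) (x₀ + a), 0 < m (x, y) →
      ∀ r ∈ Set.Icc x (x₀ + a) ×ˢ {y}, 0 < m r := by
    rintro y hy x hx hmx ⟨x', y'⟩ ⟨hx', rfl⟩
    exact hmx.trans_le ((hmono _ (hbW hy).2).monotoneOn hx ⟨hx.1.trans hx'.1, hx'.2⟩ hx'.1)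
  -- Some point of `Ω` lies in the window. From it, move right to the edge x₀ + a, along that edge,
  -- and back left: `m` stays positive on the way, so the path cannot leave `Ω`. Thus `Ω` contains
  -- every point of the window where `m > 0`.
  obtain ⟨⟨x₁, y₁⟩, hr₁, hr₁Ω⟩ : ((Set.Ioo (x₀ - a) (x₀ + a) ×ˢ Set.Ioo (y₀ - b) (y₀ + b)) ∩
      Ω).Nonempty :=
    mem_closure_iff.1 hr₀.1 _ (isOpen_Ioo.prod isOpen_Ioo)
      ⟨⟨by linarith, by linarith⟩, ⟨by linarith, by linarith⟩⟩
  have hx₁ := Set.Ioo_subset_Icc_self hr₁.1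
  have hy₁ := Set.Ioo_subset_Icc_self hr₁.2
  have hedge₁ : (x₀ + a, y₁) ∈ Ω :=
    hlift (Set.Icc x₁ (x₀ + a) ×ˢ {y₁}) (isPreconnected_Icc.prod isPreconnected_singleton)
      ⟨(x₁, y₁), ⟨⟨le_rfl, hx₁.2⟩, rfl⟩, hr₁Ω⟩ (hslice y₁ hy₁ x₁ hx₁ (hpos _ hr₁Ω))
      ⟨⟨hx₁.2, le_rfl⟩, rfl⟩
  have hedge : ∀ y ∈ Set.Icc (y₀ - b) (y₀ + b), (x₀ + a, y) ∈ Ω := by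
    intro y hy
    refine hlift ({x₀ + a} ×ˢ Set.Icc (y₀ - b) (y₀ + b))
      (isPreconnected_singleton.prod isPreconnected_Icc) ⟨(x₀ + a, y₁), ⟨rfl, hy₁⟩, hedge₁⟩ ?_ ⟨rfl, hy⟩
    rintro ⟨x', y'⟩ ⟨rfl, hy'⟩
    exact hε₀pos.trans (hbW hy').1.2
  have hfull : ∀ y ∈ Set.Icc (y₀ - b) (y₀ + b), ∀ x ∈ Set.Icc (x₀ - a) (x₀ + a), 0 < m (x, y) →
      (x, y) ∈ Ω := fun y hy x hx hmx =>
    hlift (Set.Icc x (x₀ + a) ×ˢ {y}) (isPreconnected_Icc.prod isPreconnected_singleton)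
      ⟨(x₀ + a, y), ⟨⟨hx.2, le_rfl⟩, rfl⟩, hedge y hy⟩ (hslice y hy x hx hmx)
      ⟨⟨le_rfl, hx.2⟩, rfl⟩
  -- The window has height 2b, and on each slice `m` grows with slope at most `M` from a zero z, so
  -- it stays below ε on (z, z + ε/M). This interval ends inside the window because `m` exceeds ε₀
  -- at the right edge.
  refine ⟨2 * b / M, by positivity, ε₀, hε₀pos, fun ε hε hεε₀ => ?_⟩
  have hmeas : MeasurableSet (U ∩ Ω ∩ {r | m r < ε}) :=
    ((hU.inter hΩ).inter (isOpen_lt hm.continuous continuous_const)).measurableSet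
  rw [Measure.volume_eq_prod, Measure.prod_apply_symm hmeas]
  have hle : ∀ y ∈ Set.Icc (y₀ - b) (y₀ + b), ENNReal.ofReal (ε / M) ≤
      volume ((fun x => (x, y)) ⁻¹' (U ∩ Ω ∩ {r | m r < ε})) := by
    intro y hy
    obtain ⟨⟨hyl, hyr⟩, hya⟩ := hbW hy
    obtain ⟨z, hz, hmz⟩ : ∃ z ∈ Set.Icc (x₀ - a) (x₀ + a), m (z, y) = 0 :=
      intermediate_value_Icc (f := fun x => m (x, y)) (by linarith)
        (fun x _ => (hder x y).continuousAt.continuousWithinAt) ⟨le_of_lt hyl, (hε₀pos.trans hyr).le⟩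
    have hzr : z + ε / M ≤ x₀ + a := by
      have h1 := hlip y hya z hz _ hxr hz.2
      have h2 : ε₀ < m (x₀ + a, y) := hyr
      have h3 : ε / M ≤ x₀ + a - z := by
        rw [div_le_iff₀ hMpos]; linarith
      linarith
    have hsub : Set.Ioo z (z + ε / M) ⊆ (fun x => (x, y)) ⁻¹' (U ∩ Ω ∩ {r | m r < ε}) := by
      intro x hx
      have hxI : x ∈ Set.Icc (x₀ - a) (x₀ + a) := ⟨hz.1.trans hx.1.le, hx.2.le.trans hzr⟩
      have hmx : 0 < m (x, y) := by
        have := hmono y hya hz hxI hx.1; simpa [hmz] using this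
      refine ⟨⟨(hball ⟨hxI, hya⟩).1.1, hfull y hy x hxI hmx⟩, ?_⟩
      have h1 := hlip y hya z hz x hxI hx.1.le
      have h2 : M * (x - z) < ε := by
        rw [← lt_div_iff₀' hMpos]; linarith [hx.2]
      simp only [Set.mem_ofPred_eq]
      linarith
    calc ENNReal.ofReal (ε / M) = volume (Set.Ioo z (z + ε / M)) := by
          rw [Real.volume_Ioo]; congr 1; ring
      _ ≤ _ := measure_mono hsub
  calc ENNReal.ofReal (2 * b / M * ε) = ENNReal.ofReal (ε / M) *
        volume (Set.Icc (y₀ - b) (y₀ + b)) := by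
        rw [Real.volume_Icc, ← ENNReal.ofReal_mul (by positivity)]; congr 1; field_simp; ring
    _ = ∫⁻ _ in Set.Icc (y₀ - b) (y₀ + b), ENNReal.ofReal (ε / M) := by
        rw [setLIntegral_const]
    _ ≤ ∫⁻ y in Set.Icc (y₀ - b) (y₀ + b),
          volume ((fun x => (x, y)) ⁻¹' (U ∩ Ω ∩ {r | m r < ε})) :=
        setLIntegral_mono' measurableSet_Icc hle
    _ ≤ _ := setLIntegral_le_lintegral _ _

/-- The densities n e^{-nm} concentrate near the boundary and replace a surface measure there.
Integration by parts shows that the integral of F (∂ₓm)² against them tends to 0, whereas a boundary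
point with F > 0 and ∂ₓm > 0 would keep it away from 0. -/
theorem eq_zero_of_setIntegral_fderiv_mul_fderiv_eq_zero {Ω : Set (ℝ × ℝ)} (hΩ : IsOpen Ω)
    (hb : Bornology.IsBounded Ω) {m F : ℝ × ℝ → ℝ} (hm : ContDiff ℝ 2 m) (hF : ContDiff ℝ 1 F)
    (hpos : ∀ r ∈ Ω, 0 < m r) (h0 : ∀ r ∈ frontier Ω, m r = 0) (hF0 : ∀ r, 0 ≤ F r)
    (hint : ∫ r in Ω, fderiv ℝ (fun r => F r * fderiv ℝ m r (1, 0)) r (1, 0) = 0)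
    {r₀ : ℝ × ℝ} (hr₀ : r₀ ∈ frontier Ω) (hx : 0 < fderiv ℝ m r₀ (1, 0)) : F r₀ = 0 := by
  by_contra hFne
  have hFpos : 0 < F r₀ := lt_of_le_of_ne (hF0 r₀) (Ne.symm hFne)
  set mx : ℝ × ℝ → ℝ := fun r => fderiv ℝ m r (1, 0) with hmx
  have hmxd : ContDiff ℝ 1 mx := (hm.fderiv_right (m := 1) (by norm_num)).clm_apply contDiff_const
  set G : ℝ × ℝ → ℝ := fun r => F r * mx r with hG
  have hGd : ContDiff ℝ 1 G := hF.mul hmxd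
  have hm1 : ContDiff ℝ 1 m := hm.of_le (by norm_num)
  have hGx : Continuous fun r => fderiv ℝ G r (1, 0) :=
    (hGd.continuous_fderiv (by norm_num)).clm_apply continuous_const
  have hmc := hm.continuous
  have hmxc := hmxd.continuous
  have hFc := hF.continuous
  have hIBP : ∀ n : ℕ, ∫ r in Ω, n * (F r * mx r ^ 2) * Real.exp (-(n * m r)) =
      ∫ r in Ω, fderiv ℝ G r (1, 0) * Real.exp (-(n * m r)) := by
    intro n
    -- The cut-off 1 - e^{-nm} vanishes on the frontier, so the divergence theorem applies; `hint`
    -- then removes the term ∫ ∂ₓG.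
    have hφ : ContDiff ℝ 1 fun r => G r * (1 - Real.exp (-(n * m r))) := by fun_prop
    have hz := setIntegral_fderiv_fst_eq_zero_of_frontier hΩ hb hφ
      (fun r hr => by simp [h0 r hr])
    have hfd : ∀ r, fderiv ℝ (fun r => G r * (1 - Real.exp (-(n * m r)))) r (1, 0) =
        fderiv ℝ G r (1, 0) - fderiv ℝ G r (1, 0) * Real.exp (-(n * m r)) +
          n * (F r * mx r ^ 2) * Real.exp (-(n * m r)) := by
      intro r
      have d1 := (hGd.differentiable (by norm_num) r).hasFDerivAt
      have d2 := (hm1.differentiable (by norm_num) r).hasFDerivAt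
      have d3 : HasFDerivAt (fun r => G r * (1 - Real.exp (-(n * m r)))) _ r := d1.mul ((((d2.const_mul (n : ℝ)).neg).exp).const_sub 1)
      rw [d3.fderiv]
      simp [hG, hmx]
      ring
    simp only [hfd] at hz
    have c1 : Continuous fun r => fderiv ℝ G r (1, 0) * Real.exp (-(n * m r)) := by fun_prop
    have c2 : Continuous fun r => n * (F r * mx r ^ 2) * Real.exp (-(n * m r)) := by fun_prop
    have i0 := hGx.integrableOn_of_isBounded (μ := volume) hb
    have i1 := c1.integrableOn_of_isBounded (μ := volume) hb
    have i2 := c2.integrableOn_of_isBounded (μ := volume) hb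
    have i01 : IntegrableOn (fun r => fderiv ℝ G r (1, 0) -
      fderiv ℝ G r (1, 0) * Real.exp (-(n * m r))) Ω := i0.sub i1
    rw [integral_add i01 i2, integral_sub i0 i1, hint] at hz
    linarith
  have hlim : Filter.Tendsto
      (fun n : ℕ => ∫ r in Ω, n * (F r * mx r ^ 2) * Real.exp (-(n * m r)))
      Filter.atTop (nhds 0) := by
    simp only [hIBP]
    suffices h : Filter.Tendsto
        (fun n : ℕ => ∫ r in Ω, fderiv ℝ G r (1, 0) * Real.exp (-(n * m r)))
        Filter.atTop (nhds (∫ _ in Ω, (0 : ℝ))) by simpa only [integral_zero] using h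
    refine tendsto_integral_of_dominated_convergence (fun r => ‖fderiv ℝ G r (1, 0)‖) ?_ ?_ ?_ ?_
    · intro n
      have c1 : Continuous fun r => fderiv ℝ G r (1, 0) * Real.exp (-(n * m r)) := by fun_prop
      exact c1.aestronglyMeasurable
    · exact (hGx.integrableOn_of_isBounded hb).norm
    · intro n
      filter_upwards [ae_restrict_mem hΩ.measurableSet] with r hr
      rw [norm_mul]
      refine mul_le_of_le_one_right (norm_nonneg _) ?_
      rw [Real.norm_eq_abs, abs_of_pos (Real.exp_pos _), Real.exp_le_one_iff]
      have := hpos r hr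
      have : 0 ≤ (n : ℝ) * m r := by positivity
      linarith
    · filter_upwards [ae_restrict_mem hΩ.measurableSet] with r hr
      suffices h : Filter.Tendsto (fun n : ℕ => fderiv ℝ G r (1, 0) * Real.exp (-(n * m r)))
          Filter.atTop (nhds (fderiv ℝ G r (1, 0) * 0)) by simpa only [mul_zero] using h
      refine Filter.Tendsto.const_mul _ (Real.tendsto_exp_neg_atTop_nhds_zero.comp ?_)
      exact tendsto_natCast_atTop_atTop.atTop_mul_const (hpos r hr)
  set δ : ℝ := F r₀ * mx r₀ ^ 2 / 2 with hδ
  have hδpos : 0 < δ := by positivity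
  obtain ⟨κ, hκ, ε₀, hε₀, hvol⟩ := exists_mul_le_volume_sublevel hΩ hm1 hpos h0 hr₀ hx
    (U := {r | δ < F r * mx r ^ 2}) (isOpen_lt continuous_const (by fun_prop))
    (by
      simp only [Set.mem_ofPred_eq, hδ]
      have : 0 < F r₀ * mx r₀ ^ 2 := by positivity
      linarith)
  -- On the layer m < 1/n near `r₀` the integrand is at least n δ e⁻¹, and the layer has area at
  -- least κ/n: the factors n cancel.
  have hge : δ * Real.exp (-1) * κ ≤ 0 := by
    refine ge_of_tendsto hlim ?_
    filter_upwards [Filter.eventually_ge_atTop 1,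
      tendsto_natCast_atTop_atTop.eventually_ge_atTop (1 / ε₀)] with n hn1 hn
    have hn0 : (0 : ℝ) < n := by exact_mod_cast hn1
    have hε : 1 / (n : ℝ) ≤ ε₀ := by
      rw [div_le_iff₀ hn0]; rwa [div_le_iff₀' hε₀] at hn
    have hv := hvol (1 / n) (by positivity) hε
    set S : Set (ℝ × ℝ) := {r | δ < F r * mx r ^ 2} ∩ Ω ∩ {r | m r < 1 / n} with hS
    have hSΩ : S ⊆ Ω := fun r hr => hr.1.2
    have hSm : MeasurableSet S :=
      (((isOpen_lt continuous_const (by fun_prop)).inter hΩ).inter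
        (isOpen_lt hmc continuous_const)).measurableSet
    have hSfin : volume S ≠ ⊤ := ((hb.subset hSΩ).measure_lt_top).ne
    have hv' : κ * (1 / n) ≤ volume.real S := (ENNReal.ofReal_le_iff_le_toReal hSfin).1 hv
    have c2 : Continuous fun r => n * (F r * mx r ^ 2) * Real.exp (-(n * m r)) := by fun_prop
    have i2 := c2.integrableOn_of_isBounded (μ := volume) hb
    calc δ * Real.exp (-1) * κ = n * δ * Real.exp (-1) * (κ * (1 / n)) := by field_simp
      _ ≤ n * δ * Real.exp (-1) * volume.real S := by gcongr
      _ = ∫ _ in S, n * δ * Real.exp (-1) := by rw [setIntegral_const, smul_eq_mul, mul_comm]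
      _ ≤ ∫ r in S, n * (F r * mx r ^ 2) * Real.exp (-(n * m r)) := by
          refine setIntegral_mono_on (integrableOn_const hSfin) (i2.mono_set hSΩ) hSm ?_
          rintro r ⟨⟨h1, -⟩, h3⟩
          have h1' : δ ≤ F r * mx r ^ 2 := le_of_lt h1
          have h3' : (n : ℝ) * m r ≤ 1 := by
            have := (lt_div_iff₀' hn0).1 (show m r < 1 / n from h3); exact this.le
          have := hF0 r
          gcongr
      _ ≤ ∫ r in Ω, n * (F r * mx r ^ 2) * Real.exp (-(n * m r)) := by
          refine setIntegral_mono_set i2 (Filter.Eventually.of_forall fun r => ?_)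
            (Filter.Eventually.of_forall hSΩ)
          have := hF0 r
          simp only [Pi.zero_apply]
          positivity
  have : 0 < δ * Real.exp (-1) * κ := by positivity
  linarith

/-! ### Transfer to the other coordinate direction -/

/-- A direction which is the image of the horizontal one under a measure-preserving linear change
of coordinates of the plane. -/
def IsCoordinateDirection (v : ℝ × ℝ) : Prop :=
  ∃ T : (ℝ × ℝ) ≃L[ℝ] (ℝ × ℝ), MeasurePreserving T ∧ T (1, 0) = v

theorem isCoordinateDirection_fst : IsCoordinateDirection (1, 0) :=
  ⟨.refl ℝ _, .id _, rfl⟩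

theorem isCoordinateDirection_snd : IsCoordinateDirection (0, 1) :=
  ⟨ContinuousLinearEquiv.prodComm ℝ ℝ ℝ, Measure.measurePreserving_swap, rfl⟩

theorem IsCoordinateDirection.neg {v : ℝ × ℝ} (hv : IsCoordinateDirection v) :
    IsCoordinateDirection (-v) := by
  obtain ⟨T, hT, rfl⟩ := hv
  exact ⟨T.trans (.neg ℝ), (Measure.measurePreserving_neg volume).comp hT, rfl⟩

theorem fderiv_comp_continuousLinearEquiv {E : Type*} [NormedAddCommGroup E] [NormedSpace ℝ E]
    {f : ℝ × ℝ → E} (hf : Differentiable ℝ f) (T : (ℝ × ℝ) ≃L[ℝ] (ℝ × ℝ)) (r w : ℝ × ℝ) :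
    fderiv ℝ (fun s => f (T s)) r w = fderiv ℝ f (T r) (T w) := by
  have := (hf (T r)).hasFDerivAt.comp r T.hasFDerivAt
  rw [show (fun s => f (T s)) = f ∘ T from rfl, this.fderiv]
  rfl

theorem frontier_preimage_continuousLinearEquiv (T : (ℝ × ℝ) ≃L[ℝ] (ℝ × ℝ)) (Ω : Set (ℝ × ℝ)) :
    frontier (T ⁻¹' Ω) = T ⁻¹' frontier Ω :=
  (T.toHomeomorph.preimage_frontier Ω).symm

theorem isBounded_preimage_continuousLinearEquiv (T : (ℝ × ℝ) ≃L[ℝ] (ℝ × ℝ)) {Ω : Set (ℝ × ℝ)}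
    (hb : Bornology.IsBounded Ω) : Bornology.IsBounded (T ⁻¹' Ω) :=
  T.antilipschitz.isBounded_preimage hb

theorem setIntegral_preimage_continuousLinearEquiv {E : Type*} [NormedAddCommGroup E]
    [NormedSpace ℝ E] {T : (ℝ × ℝ) ≃L[ℝ] (ℝ × ℝ)} (hT : MeasurePreserving T) (f : ℝ × ℝ → E)
    (Ω : Set (ℝ × ℝ)) : ∫ r in T ⁻¹' Ω, f (T r) = ∫ r in Ω, f r :=
  hT.setIntegral_preimage_emb T.toHomeomorph.measurableEmbedding f Ω

theorem setIntegral_fderiv_eq_zero_of_frontier {E : Type*} [NormedAddCommGroup E]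
    [NormedSpace ℝ E] [CompleteSpace E] {v : ℝ × ℝ} (hv : IsCoordinateDirection v)
    {Ω : Set (ℝ × ℝ)} (hΩ : IsOpen Ω) (hb : Bornology.IsBounded Ω) {φ : ℝ × ℝ → E}
    (hφ : ContDiff ℝ 1 φ) (h0 : ∀ r ∈ frontier Ω, φ r = 0) :
    ∫ r in Ω, fderiv ℝ φ r v = 0 := by
  obtain ⟨T, hT, rfl⟩ := hv
  rw [← setIntegral_preimage_continuousLinearEquiv hT]
  simp only [← fderiv_comp_continuousLinearEquiv (hφ.differentiable (by norm_num)) T]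
  refine setIntegral_fderiv_fst_eq_zero_of_frontier (hΩ.preimage T.continuous)
    (isBounded_preimage_continuousLinearEquiv T hb) (hφ.comp T.contDiff) fun r hr => ?_
  rw [frontier_preimage_continuousLinearEquiv] at hr
  exact h0 _ hr

theorem IsCoordinateDirection.eq_zero_of_fderiv_pos {v : ℝ × ℝ} (hv : IsCoordinateDirection v)
    {Ω : Set (ℝ × ℝ)} (hΩ : IsOpen Ω)
    (hb : Bornology.IsBounded Ω) {m F : ℝ × ℝ → ℝ} (hm : ContDiff ℝ 2 m) (hF : ContDiff ℝ 1 F)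
    (hpos : ∀ r ∈ Ω, 0 < m r) (h0 : ∀ r ∈ frontier Ω, m r = 0) (hF0 : ∀ r, 0 ≤ F r)
    (hint : ∫ r in Ω, fderiv ℝ (fun r => F r * fderiv ℝ m r v) r v = 0)
    {r₀ : ℝ × ℝ} (hr₀ : r₀ ∈ frontier Ω) (hx : 0 < fderiv ℝ m r₀ v) : F r₀ = 0 := by
  obtain ⟨T, hT, rfl⟩ := hv
  have hmd := hm.differentiable (by norm_num)
  have hmx : ContDiff ℝ 1 fun r => fderiv ℝ m r (T (1, 0)) :=
    (hm.fderiv_right (m := 1) (by norm_num)).clm_apply contDiff_const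
  obtain ⟨s, rfl⟩ := T.surjective r₀
  refine eq_zero_of_setIntegral_fderiv_mul_fderiv_eq_zero (hΩ.preimage T.continuous)
    (isBounded_preimage_continuousLinearEquiv T hb) (m := fun r => m (T r)) (F := fun r => F (T r))
    (r₀ := s) (hm.comp T.contDiff) (hF.comp T.contDiff) (fun r hr => hpos _ hr) ?_
    (fun r => hF0 _) ?_ ?_ ?_
  · intro r hr
    rw [frontier_preimage_continuousLinearEquiv] at hr
    exact h0 _ hr
  · simp only [fderiv_comp_continuousLinearEquiv hmd T]
    have hd : Differentiable ℝ fun r => F r * fderiv ℝ m r (T (1, 0)) :=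
      (hF.mul hmx).differentiable (by norm_num)
    simp only [fderiv_comp_continuousLinearEquiv hd T]
    rw [setIntegral_preimage_continuousLinearEquiv hT
      (fun r => fderiv ℝ (fun r => F r * fderiv ℝ m r (T (1, 0))) r (T (1, 0)))]
    exact hint
  · rw [frontier_preimage_continuousLinearEquiv]
    exact hr₀
  · rwa [fderiv_comp_continuousLinearEquiv hmd T]

/-- If `m > 0` on `Ω` and `m = 0` on its boundary, the flux `∫_Ω ∂ᵥ(F ∂ᵥm)` of a weight `F ≥ 0`
vanishes only if `F ∂ᵥm` vanishes on the boundary. -/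
theorem IsCoordinateDirection.eq_zero_or_fderiv_eq_zero {v : ℝ × ℝ} (hv : IsCoordinateDirection v)
    {Ω : Set (ℝ × ℝ)} (hΩ : IsOpen Ω)
    (hb : Bornology.IsBounded Ω) {m F : ℝ × ℝ → ℝ} (hm : ContDiff ℝ 2 m) (hF : ContDiff ℝ 1 F)
    (hpos : ∀ r ∈ Ω, 0 < m r) (h0 : ∀ r ∈ frontier Ω, m r = 0) (hF0 : ∀ r, 0 ≤ F r)
    (hint : ∫ r in Ω, fderiv ℝ (fun r => F r * fderiv ℝ m r v) r v = 0)
    {r₀ : ℝ × ℝ} (hr₀ : r₀ ∈ frontier Ω) : F r₀ = 0 ∨ fderiv ℝ m r₀ v = 0 := by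
  rcases lt_trichotomy (fderiv ℝ m r₀ v) 0 with h | h | h
  -- The flux is quadratic in `v`, so passing to `-v` preserves it while reversing the sign of the
  -- derivative of `m`.
  · refine Or.inl (hv.neg.eq_zero_of_fderiv_pos hΩ hb hm hF hpos h0 hF0 ?_ hr₀ (by simpa using h))
    simp only [map_neg, mul_neg, fderiv_fun_neg]
    simpa using hint
  · exact Or.inr h
  · exact Or.inl (hv.eq_zero_of_fderiv_pos hΩ hb hm hF hpos h0 hF0 hint hr₀ h)

/-! ### The boundary of a simply connected open set has no isolated points -/

/-- A closed continuous curve cannot be a logarithm of `θ ↦ ρ exp(jθ)` on `[0, 2π]`. -/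
theorem not_continuous_log_on_circle {ρ : ℝ} (f : ℝ → ℂ) (hf : Continuous f)
    (hper : f (2 * Real.pi) = f 0)
    (hexp : ∀ θ : ℝ, Complex.exp (f θ) = ρ * Complex.exp (θ * Complex.I)) : False := by
  have hint : ∀ θ : ℝ, ∃ n : ℤ, (f θ).im - θ - (f 0).im = n * (2 * Real.pi) := by
    intro θ
    have h1 : Complex.exp (f θ - θ * Complex.I) = Complex.exp (f 0) := by
      rw [Complex.exp_sub, hexp, hexp]
      simp
    obtain ⟨n, hn⟩ := Complex.exp_eq_exp_iff_exists_int.1 h1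
    refine ⟨n, ?_⟩
    have := congrArg Complex.im hn
    simp at this
    linarith
  have hc : Continuous fun θ : ℝ => (f θ).im - θ - (f 0).im := by fun_prop
  have hπ := Real.pi_pos
  -- The function is 0 at 0 and -2π at 2π, so it takes the value -π, which is not a multiple of 2π.
  obtain ⟨θ, -, hθ⟩ : (-Real.pi) ∈ (fun θ : ℝ => (f θ).im - θ - (f 0).im) ''
      Set.Icc 0 (2 * Real.pi) := by
    refine intermediate_value_Icc' (by positivity) hc.continuousOn ⟨?_, ?_⟩
    · rw [hper]; linarith
    · linarith
  obtain ⟨n, hn⟩ := hint θ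
  simp only at hθ
  rw [hθ] at hn
  have h2 : (n : ℝ) * 2 = -1 := by
    apply mul_right_cancel₀ hπ.ne'
    linarith
  have h3 : n * 2 = -1 := by exact_mod_cast h2
  omega

/-- The boundary of a simply connected open subset of the plane has no isolated points. -/
theorem IsSimplyConnected.frequently_mem_frontier {Ω : Set (ℝ × ℝ)} (hsc : IsSimplyConnected Ω)
    (hΩ : IsOpen Ω) {r₀ : ℝ × ℝ} (hr₀ : r₀ ∈ frontier Ω) :
    ∃ᶠ r in nhdsWithin r₀ {r₀}ᶜ, r ∈ frontier Ω := by
  intro hev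
  rw [eventually_nhdsWithin_iff, Metric.eventually_nhds_iff_ball] at hev
  obtain ⟨ε, hε, hball⟩ := hev
  have hr₀Ω : r₀ ∉ Ω := by rw [hΩ.frontier_eq] at hr₀; exact hr₀.2
  set P : ℝ × ℝ → ℝ × ℝ := fun s =>
    (r₀.1 + s.1 * Real.cos s.2, r₀.2 + s.1 * Real.sin s.2) with hP
  have hPc : Continuous P := by fun_prop
  set A := P '' (Set.Ioo 0 ε ×ˢ Set.univ) with hA
  have hApre : IsPreconnected A :=
    (isPreconnected_Ioo.prod isPreconnected_univ).image _ hPc.continuousOn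
  have hAd : ∀ r ∈ A, r ∉ frontier Ω := by
    rintro _ ⟨⟨ρ, θ⟩, ⟨hρ, -⟩, rfl⟩
    refine hball _ ?_ ?_
    · rw [Metric.mem_ball, Prod.dist_eq, max_lt_iff]
      simp only [hP, dist_self_add_left, norm_mul, Real.norm_eq_abs, abs_of_pos hρ.1]
      exact ⟨(mul_le_of_le_one_right hρ.1.le (Real.abs_cos_le_one _)).trans_lt hρ.2,
        (mul_le_of_le_one_right hρ.1.le (Real.abs_sin_le_one _)).trans_lt hρ.2⟩
    · intro h
      have h1 := congrArg Prod.fst h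
      have h2 := congrArg Prod.snd h
      simp only [hP, add_eq_left, mul_eq_zero, hρ.1.ne', false_or] at h1 h2
      have := Real.sin_sq_add_cos_sq θ
      rw [h1, h2] at this
      norm_num at this
  have hAne : (A ∩ Ω).Nonempty := by
    -- The plane carries the sup metric: coordinates below ε/2 give Euclidean norm below ε, the
    -- radius of the punctured disc `A`.
    obtain ⟨r, hrΩ, hr⟩ := Metric.mem_closure_iff.1 hr₀.1 (ε / 2) (by positivity)
    refine ⟨r, ?_, hrΩ⟩
    set z : ℂ := ⟨r.1 - r₀.1, r.2 - r₀.2⟩ with hz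
    have hzne : z ≠ 0 := by
      intro h
      have h1 := congrArg Complex.re h
      have h2 := congrArg Complex.im h
      simp only [hz, Complex.zero_re, Complex.zero_im, sub_eq_zero] at h1 h2
      exact hr₀Ω (by rwa [← (Prod.ext h1 h2 : r = r₀)])
    rw [dist_comm, Prod.dist_eq, max_lt_iff, Real.dist_eq, Real.dist_eq] at hr
    refine ⟨(‖z‖, z.arg), ⟨⟨norm_pos_iff.2 hzne, ?_⟩, Set.mem_univ _⟩, ?_⟩
    · have := Complex.norm_le_abs_re_add_abs_im z
      simp only [hz] at this ⊢
      linarith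
    · simp only [hP, Complex.norm_mul_cos_arg, Complex.norm_mul_sin_arg]
      simp [hz]
  have hAΩ : A ⊆ Ω := hApre.subset_of_disjoint_frontier hΩ hAne hAd
  -- The punctured disc lies in `Ω` and its centre does not. Simple connectedness gives a continuous
  -- logarithm of r - r₀ on `Ω`, which the circle of radius ε/2 forbids.
  obtain ⟨f, hfc, hfe⟩ := Complex.exists_continuousOn_eqOn_exp_comp hsc hΩ
    (g := fun r : ℝ × ℝ => ((r.1 - r₀.1 : ℝ) : ℂ) + ((r.2 - r₀.2 : ℝ) : ℂ) * Complex.I)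
    (by fun_prop) (by
      rintro ⟨r, hr, h⟩
      have h1 := congrArg Complex.re h
      have h2 := congrArg Complex.im h
      simp [sub_eq_zero] at h1 h2
      exact hr₀Ω (by rwa [← (Prod.ext h1 h2 : r = r₀)]))
  have hmem : ∀ θ : ℝ, P (ε / 2, θ) ∈ Ω := fun θ =>
    hAΩ ⟨(ε / 2, θ), ⟨⟨by positivity, by linarith⟩, Set.mem_univ _⟩, rfl⟩
  refine not_continuous_log_on_circle (ρ := ε / 2) (fun θ => f (P (ε / 2, θ)))
    (hfc.comp_continuous (by fun_prop) hmem) (by simp [hP]) fun θ => ?_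
  have := hfe (hmem θ)
  simp only [Function.comp_apply] at this
  rw [this, Complex.exp_mul_I]
  simp [hP]
  ring

/-! ### Divisibility and common zeros of bivariate polynomials -/

section Bivariate

open Polynomial

theorem Prime.isPrimitive_of_natDegree_ne_zero {R : Type*} [CommRing R] [IsDomain R] {p : R[X]}
    (hp : Prime p) (hd : p.natDegree ≠ 0) : p.IsPrimitive := by
  rintro r ⟨s, rfl⟩
  rcases hp.irreducible.isUnit_or_isUnit rfl with h | h
  · exact isUnit_C.1 h
  · refine absurd ?_ hd
    obtain ⟨t, -, rfl⟩ := isUnit_iff.1 h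
    rw [← C_mul, natDegree_C]

/-- By Gauss's lemma `p` stays irreducible over K(X) and still does not divide `q`, so the two are
coprime there; clear denominators in a Bézout identity. If `p` is constant in the outer variable, it
is itself the eliminant. -/
theorem Prime.exists_elimination {K : Type*} [Field K] {p q : K[X][X]} (hp : Prime p)
    (hpq : ¬ p ∣ q) : ∃ a b : K[X][X], ∃ r : K[X], r ≠ 0 ∧ a * p + b * q = C r := by
  classical
  by_cases hd : p.natDegree = 0
  · obtain ⟨r, rfl⟩ := natDegree_eq_zero.1 hd
    exact ⟨1, 0, r, fun h => hp.ne_zero (by simp [h]), by simp⟩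
  let : NormalizedGCDMonoid K[X] := Classical.choice inferInstance
  have hprim := hp.isPrimitive_of_natDegree_ne_zero hd
  let F := FractionRing K[X]
  have hirr : Irreducible (p.map (algebraMap K[X] F)) :=
    (hprim.irreducible_iff_irreducible_map_fraction_map).1 hp.irreducible
  have hnd : ¬ p.map (algebraMap K[X] F) ∣ q.map (algebraMap K[X] F) :=
    fun h => hpq (hprim.dvd_of_fraction_map_dvd_fraction_map h)
  obtain ⟨a, b, hab⟩ := (hirr.coprime_iff_not_dvd).2 hnd
  obtain ⟨s, hs, hsa⟩ := IsLocalization.integerNormalization_spec (nonZeroDivisors K[X]) a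
  obtain ⟨t, ht, htb⟩ := IsLocalization.integerNormalization_spec (nonZeroDivisors K[X]) b
  refine ⟨C t * IsLocalization.integerNormalization (nonZeroDivisors K[X]) a,
    C s * IsLocalization.integerNormalization (nonZeroDivisors K[X]) b, s * t,
    mul_ne_zero (nonZeroDivisors.ne_zero hs) (nonZeroDivisors.ne_zero ht), ?_⟩
  apply map_injective (algebraMap K[X] F) (IsFractionRing.injective K[X] F)
  simp only [Polynomial.map_add, Polynomial.map_mul, map_C, hsa, htb, map_mul]
  simp only [Algebra.smul_def, Polynomial.algebraMap_apply]
  linear_combination (C (algebraMap K[X] F s) * C (algebraMap K[X] F t)) * hab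

theorem map_evalRingHom_eq_zero_iff {K : Type*} [Field K] {p : K[X][X]} {x : K} :
    p.map (evalRingHom x) = 0 ↔ C (X - C x) ∣ p := by
  rw [C_dvd_iff_dvd_coeff, Polynomial.ext_iff]
  simp [dvd_iff_isRoot]

/-- A prime bivariate polynomial has finitely many common zeros with one that it does not
divide. -/
theorem Prime.finite_setOf_common_zero {K : Type*} [Field K] {p q : K[X][X]} (hp : Prime p)
    (hpq : ¬ p ∣ q) :
    {z : K × K | p.evalEval z.1 z.2 = 0 ∧ q.evalEval z.1 z.2 = 0}.Finite := by
  classical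
  obtain ⟨a, b, r, hr, hab⟩ := hp.exists_elimination hpq
  have hfib : ∀ x : K, {y : K | p.evalEval x y = 0 ∧ q.evalEval x y = 0}.Finite := by
    intro x
    -- If `p` vanishes on the whole line over `x`, it is associated to X - x, and then `q` cannot
    -- vanish on that line.
    by_cases h : p.map (evalRingHom x) = 0
    · have hq : q.map (evalRingHom x) ≠ 0 := by
        rw [Ne, map_evalRingHom_eq_zero_iff]
        rw [map_evalRingHom_eq_zero_iff] at h
        have hx : Prime (C (X - C x) : K[X][X]) := prime_C_iff.2 (prime_X_sub_C x)
        exact fun hq => hpq (((hx.associated_of_dvd hp h).dvd_iff_dvd_left).1 hq)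
      refine (finite_setOfPred_isRoot hq).subset fun y hy => ?_
      simp only [Set.mem_ofPred_eq, IsRoot.def, map_evalRingHom_eval]
      exact hy.2
    · refine (finite_setOfPred_isRoot h).subset fun y hy => ?_
      simp only [Set.mem_ofPred_eq, IsRoot.def, map_evalRingHom_eval]
      exact hy.1
  have hsub : {z : K × K | p.evalEval z.1 z.2 = 0 ∧ q.evalEval z.1 z.2 = 0} ⊆
      ⋃ x ∈ {x | r.IsRoot x}, Prod.mk x '' {y : K | p.evalEval x y = 0 ∧ q.evalEval x y = 0} := by
    rintro ⟨x, y⟩ ⟨h1, h2⟩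
    have h := congrArg (evalEval x y) hab
    simp only [evalEval_add, evalEval_mul, evalEval_C] at h
    simp only [h1, h2, mul_zero, add_zero] at h
    exact Set.mem_biUnion (x := x) h.symm ⟨y, ⟨h1, h2⟩, rfl⟩
  exact ((finite_setOfPred_isRoot hr).biUnion fun x _ => (hfib x).image _).subset hsub

theorem eq_zero_of_evalEval_eq_zero_of_infinite {K : Type*} [Field K] {S : Set K}
    (hS : S.Infinite) {p : K[X][X]} (h : ∀ x ∈ S, ∀ y ∈ S, p.evalEval x y = 0) : p = 0 := by
  have h1 : ∀ x ∈ S, p.map (evalRingHom x) = 0 := fun x hx =>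
    eq_zero_of_infinite_isRoot _ (hS.mono fun y hy => by
      simp only [Set.mem_ofPred_eq, IsRoot.def, map_evalRingHom_eval]
      exact h x hx y hy)
  ext1 n
  refine eq_zero_of_infinite_isRoot _ (hS.mono fun x hx => ?_)
  have := congrArg (fun f => coeff f n) (h1 x hx)
  simpa using this

theorem dvd_of_squarefree_of_forall_prime {R : Type*} [CommRing R] [IsDomain R]
    [UniqueFactorizationMonoid R] {a : R} (b : R) (ha0 : a ≠ 0) (ha : Squarefree a)
    (h : ∀ p, Prime p → p ∣ a → p ∣ b) : a ∣ b := by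
  induction a using WfDvdMonoid.induction_on_irreducible with
  | zero => exact absurd rfl ha0
  | unit u hu => exact hu.dvd
  | mul a i ha0' hi ih =>
    obtain ⟨t, rfl⟩ := ih ha0' (ha.squarefree_of_dvd (dvd_mul_left a i))
      fun p hp hpa => h p hp (hpa.mul_left i)
    have hip : Prime i := UniqueFactorizationMonoid.irreducible_iff_prime.1 hi
    rcases hip.dvd_or_dvd (h i hip (dvd_mul_right i a)) with hia | hit
    · exact absurd (ha i (mul_dvd_mul_left i hia)) hi.not_isUnit
    · rw [mul_comm i a]
      exact mul_dvd_mul_left a hit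

end Bivariate

/-! ### Trigonometric polynomials as polynomials on the torus -/

/-- The character `x ↦ exp(j 2π x)`. -/
noncomputable def unitExp (x : ℝ) : ℂ := Complex.exp (2 * Real.pi * Complex.I * x)

theorem unitExp_ne_zero (x : ℝ) : unitExp x ≠ 0 := Complex.exp_ne_zero _

theorem unitExp_add (x y : ℝ) : unitExp (x + y) = unitExp x * unitExp y := by
  rw [unitExp, unitExp, unitExp, ← Complex.exp_add]
  push_cast
  ring_nf

theorem unitExp_natCast_mul (n : ℕ) (x : ℝ) : unitExp (n * x) = unitExp x ^ n := by
  rw [unitExp, unitExp, ← Complex.exp_nat_mul]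
  push_cast
  ring_nf

theorem hasDerivAt_unitExp (x : ℝ) :
    HasDerivAt unitExp (2 * Real.pi * Complex.I * unitExp x) x := by
  have h := (((hasDerivAt_id (x : ℂ)).const_mul (2 * Real.pi * Complex.I : ℂ)).cexp).comp_ofReal
  convert! h using 1
  rw [unitExp, mul_one, mul_comm]
  rfl

@[fun_prop]
theorem contDiff_unitExp {n : WithTop ℕ∞} : ContDiff ℝ n unitExp :=
  (contDiff_const.mul Complex.ofRealCLM.contDiff).cexp

theorem unitExp_eq_unitExp_iff {x y : ℝ} : unitExp x = unitExp y ↔ ∃ n : ℤ, x = y + n := by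
  have hπ : (2 * Real.pi * Complex.I : ℂ) ≠ 0 := Complex.two_pi_I_ne_zero
  rw [unitExp, unitExp, Complex.exp_eq_exp_iff_exists_int]
  refine exists_congr fun n => ?_
  constructor
  · intro h
    have h' : (x : ℂ) = y + n := by
      apply mul_left_cancel₀ hπ
      linear_combination h
    exact_mod_cast h'
  · rintro rfl
    push_cast
    ring

theorem conj_unitExp (x : ℝ) : (starRingEnd ℂ) (unitExp x) = unitExp (-x) := by
  rw [unitExp, unitExp, ← Complex.exp_conj]
  simp [Complex.conj_ofNat]

theorem infinite_range_unitExp : (Set.range unitExp).Infinite := by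
  refine (isPreconnected_range (contDiff_unitExp (n := 0)).continuous).infinite_of_nontrivial
    ⟨unitExp 0, ⟨0, rfl⟩, unitExp (1 / 2), ⟨1 / 2, rfl⟩, ?_⟩
  rw [Ne, unitExp_eq_unitExp_iff]
  rintro ⟨n, hn⟩
  have h2 : (n : ℝ) * 2 = -1 := by linarith
  have h3 : n * 2 = -1 := by exact_mod_cast h2
  omega

theorem finite_setOf_unitExp_eq (u : ℂ) : {x : ℝ | x ∈ Set.Icc (0 : ℝ) 1 ∧ unitExp x = u}.Finite := by
  rcases Set.eq_empty_or_nonempty {x : ℝ | x ∈ Set.Icc (0 : ℝ) 1 ∧ unitExp x = u} with h | ⟨y, hy, rfl⟩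
  · rw [h]; exact Set.finite_empty
  · refine ((Set.finite_Icc (-1 : ℤ) 1).image fun n : ℤ => y + (n : ℝ)).subset ?_
    rintro x ⟨hx, hxy⟩
    obtain ⟨n, rfl⟩ := unitExp_eq_unitExp_iff.1 hxy
    refine ⟨n, ⟨?_, ?_⟩, rfl⟩
    · have : (-1 : ℝ) ≤ n := by linarith [hx.1, hy.2]
      exact_mod_cast this
    · have : (n : ℝ) ≤ 1 := by linarith [hx.2, hy.1]
      exact_mod_cast this

theorem finite_preimage_unitExp {S : Set (ℂ × ℂ)} (hS : S.Finite) :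
    {r : ℝ × ℝ | r ∈ Set.Icc (0 : ℝ × ℝ) 1 ∧ (unitExp r.1, unitExp r.2) ∈ S}.Finite := by
  refine (hS.biUnion fun z _ => (finite_setOf_unitExp_eq z.1).prod
    (finite_setOf_unitExp_eq z.2)).subset ?_
  rintro ⟨x, y⟩ ⟨hr, hz⟩
  exact Set.mem_biUnion hz ⟨⟨⟨hr.1.1, hr.2.1⟩, rfl⟩, ⟨⟨hr.1.2, hr.2.2⟩, rfl⟩⟩

/-- The monomial `r ↦ exp(j 2π ⟨k, r⟩)`. -/
noncomputable def trigMono (k : ℤ × ℤ) (r : ℝ × ℝ) : ℂ := unitExp (k.1 * r.1 + k.2 * r.2)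

theorem trigEval_eq_sum_of_subset {c : ℤ × ℤ →₀ ℂ} {S : Finset (ℤ × ℤ)} (h : c.support ⊆ S)
    (r : ℝ × ℝ) : trigEval c r = ∑ k ∈ S, c k * trigMono k r := by
  rw [trigEval]
  refine (Finset.sum_subset h fun k _ hk => ?_).trans (Finset.sum_congr rfl fun k _ => ?_)
  · rw [Finsupp.notMem_support_iff.1 hk, zero_mul]
  · simp [trigMono, unitExp]

theorem trigEval_add (a b : ℤ × ℤ →₀ ℂ) (r : ℝ × ℝ) :
    trigEval (a + b) r = trigEval a r + trigEval b r := by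
  classical
  rw [trigEval_eq_sum_of_subset (Finsupp.support_add (g₁ := a) (g₂ := b)),
    trigEval_eq_sum_of_subset Finset.subset_union_left,
    trigEval_eq_sum_of_subset (Finset.subset_union_right (s₁ := a.support)),
    ← Finset.sum_add_distrib]
  simp [add_mul]

theorem trigEval_single (k : ℤ × ℤ) (a : ℂ) (r : ℝ × ℝ) :
    trigEval (Finsupp.single k a) r = a * trigMono k r := by
  rw [trigEval_eq_sum_of_subset Finsupp.support_single_subset]
  simp

@[fun_prop]
theorem contDiff_trigMono {n : WithTop ℕ∞} (k : ℤ × ℤ) : ContDiff ℝ n (trigMono k) := by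
  unfold trigMono
  exact contDiff_unitExp.comp (by fun_prop)

@[fun_prop]
theorem contDiff_trigEval {n : WithTop ℕ∞} (c : ℤ × ℤ →₀ ℂ) : ContDiff ℝ n (trigEval c) := by
  rw [funext (trigEval_eq_sum_of_subset (c := c) (Finset.Subset.refl _))]
  exact ContDiff.sum fun k _ => contDiff_const.mul (contDiff_trigMono k)

section Bivariate

open Polynomial

/-- The polynomial whose value on the torus is `exp(j 2π (K x + L y))` times the trigonometric
polynomial of `c`, if `c` is supported in `freqBox K L`. -/
noncomputable def toBivariate (K L : ℕ) (c : ℤ × ℤ →₀ ℂ) : ℂ[X][X] :=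
  ∑ k ∈ freqBox K L, C (C (c k) * X ^ (k.1 + K).toNat) * X ^ (k.2 + L).toNat

theorem mem_freqBox {K L : ℕ} {k : ℤ × ℤ} :
    k ∈ freqBox K L ↔ (-(K : ℤ) ≤ k.1 ∧ k.1 ≤ K) ∧ (-(L : ℤ) ≤ k.2 ∧ k.2 ≤ L) := by
  simp [freqBox]

theorem evalEval_toBivariate {K L : ℕ} {c : ℤ × ℤ →₀ ℂ} (hc : c.support ⊆ freqBox K L)
    (r : ℝ × ℝ) : (toBivariate K L c).evalEval (unitExp r.1) (unitExp r.2) =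
      unitExp (K * r.1 + L * r.2) * trigEval c r := by
  rw [trigEval_eq_sum_of_subset hc, toBivariate, evalEval_finsetSum, Finset.mul_sum]
  refine Finset.sum_congr rfl fun k hk => ?_
  rw [mem_freqBox] at hk
  have e1 : (((k.1 + K).toNat : ℕ) : ℝ) = k.1 + K := by
    have : (((k.1 + K).toNat : ℕ) : ℤ) = k.1 + K := Int.toNat_of_nonneg (by linarith [hk.1.1])
    exact_mod_cast this
  have e2 : (((k.2 + L).toNat : ℕ) : ℝ) = k.2 + L := by
    have : (((k.2 + L).toNat : ℕ) : ℤ) = k.2 + L := Int.toNat_of_nonneg (by linarith [hk.2.1])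
    exact_mod_cast this
  rw [evalEval_mul, evalEval_C, evalEval_pow, evalEval_X, eval_mul, eval_C, eval_pow, eval_X,
    ← unitExp_natCast_mul, ← unitExp_natCast_mul, e1, e2, mul_assoc, ← unitExp_add, trigMono,
    mul_left_comm, ← unitExp_add]
  ring_nf

theorem coeff_toBivariate {K L : ℕ} {c : ℤ × ℤ →₀ ℂ} (hc : c.support ⊆ freqBox K L)
    (i j : ℕ) : ((toBivariate K L c).coeff j).coeff i = c (i - K, j - L) := by
  classical
  rw [toBivariate, finsetSum_coeff, finsetSum_coeff]
  have h : ∀ k ∈ freqBox K L, ((C (C (c k) * X ^ (k.1 + K).toNat) * X ^ (k.2 + L).toNat :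
      ℂ[X][X]).coeff j).coeff i = if k = ((i : ℤ) - K, (j : ℤ) - L) then c k else 0 := by
    intro k hk
    rw [mem_freqBox] at hk
    rw [coeff_C_mul, coeff_X_pow, mul_ite, mul_one, mul_zero, apply_ite (fun f => coeff f i),
      coeff_C_mul, coeff_X_pow, coeff_zero, mul_ite, mul_one, mul_zero, ← ite_and]
    refine if_congr ?_ rfl rfl
    rw [Prod.ext_iff]
    simp only
    omega
  rw [Finset.sum_congr rfl h, Finset.sum_ite_eq']
  split_ifs with hmem
  · rfl
  · exact (Finsupp.notMem_support_iff.1 fun h => hmem (hc h)).symm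

theorem exists_support_subset_freqBox (c : ℤ × ℤ →₀ ℂ) :
    ∃ K L : ℕ, c.support ⊆ freqBox K L := by
  refine ⟨c.support.sup fun k => k.1.natAbs, c.support.sup fun k => k.2.natAbs, fun k hk => ?_⟩
  have h1 := Finset.le_sup (f := fun k : ℤ × ℤ => k.1.natAbs) hk
  have h2 := Finset.le_sup (f := fun k : ℤ × ℤ => k.2.natAbs) hk
  rw [mem_freqBox]
  omega

theorem exists_trigEval_eq_evalEval (q : ℂ[X][X]) :
    ∃ c : ℤ × ℤ →₀ ℂ, ∀ r : ℝ × ℝ, trigEval c r = q.evalEval (unitExp r.1) (unitExp r.2) := by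
  induction q using Polynomial.induction_on' with
  | add p q hp hq =>
    obtain ⟨a, ha⟩ := hp
    obtain ⟨b, hb⟩ := hq
    exact ⟨a + b, fun r => by rw [trigEval_add, ha, hb, evalEval_add]⟩
  | monomial j f =>
    induction f using Polynomial.induction_on' with
    | add p q hp hq =>
      obtain ⟨a, ha⟩ := hp
      obtain ⟨b, hb⟩ := hq
      exact ⟨a + b, fun r => by rw [trigEval_add, ha, hb, map_add, evalEval_add]⟩
    | monomial i z =>
      refine ⟨Finsupp.single (i, j) z, fun r => ?_⟩
      rw [trigEval_single, ← C_mul_X_pow_eq_monomial, ← C_mul_X_pow_eq_monomial, evalEval_mul,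
        evalEval_C, evalEval_pow, evalEval_X, eval_mul, eval_C, eval_pow, eval_X,
        ← unitExp_natCast_mul, ← unitExp_natCast_mul, mul_assoc, ← unitExp_add, trigMono]
      simp

theorem eq_of_evalEval_unitExp_eq {p q : ℂ[X][X]}
    (h : ∀ r : ℝ × ℝ, p.evalEval (unitExp r.1) (unitExp r.2) =
      q.evalEval (unitExp r.1) (unitExp r.2)) : p = q := by
  rw [← sub_eq_zero]
  refine eq_zero_of_evalEval_eq_zero_of_infinite infinite_range_unitExp ?_
  rintro _ ⟨x, rfl⟩ _ ⟨y, rfl⟩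
  rw [evalEval_sub, h (x, y), sub_self]

/-- The cofactor may have negative frequencies, so it becomes a polynomial only after multiplication
by a monomial. The identity on the torus lifts to polynomials because the unit circle is infinite.
-/
theorem TrigDvd.exists_toBivariate_dvd {K L : ℕ} {a b : ℤ × ℤ →₀ ℂ}
    (ha : a.support ⊆ freqBox K L) {q : ℂ[X][X]}
    (hq : ∃ M N : ℕ, ∀ r : ℝ × ℝ, q.evalEval (unitExp r.1) (unitExp r.2) =
      unitExp (M * r.1 + N * r.2) * trigEval b r) (h : TrigDvd a b) :
    ∃ M N : ℕ, toBivariate K L a ∣ C X ^ M * X ^ N * q := by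
  obtain ⟨g, hg⟩ := h
  obtain ⟨M, N, hMN⟩ := hq
  obtain ⟨K', L', hgb⟩ := exists_support_subset_freqBox g
  refine ⟨K + K', L + L', (C X ^ M * X ^ N * toBivariate K' L' g), ?_⟩
  refine eq_of_evalEval_unitExp_eq fun r => ?_
  simp only [evalEval_mul, evalEval_pow, evalEval_C, eval_X, evalEval_X, hMN,
    evalEval_toBivariate ha, evalEval_toBivariate hgb, hg, ← unitExp_natCast_mul]
  simp only [unitExp_add, unitExp_natCast_mul, pow_add]
  ring

end Bivariate

/-- If the support missed a side of the box, it would fit in a box one unit narrower. Touching the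
lower sides excludes monomial factors; touching the upper sides fixes the degrees in both variables.
-/
theorem exists_mem_support_eq_of_trigDegree {K L : ℕ} {c : ℤ × ℤ →₀ ℂ}
    (hc : c.support ⊆ freqBox K L) (hdeg : trigDegree c = (2 * K + 1, 2 * L + 1)) :
    ((∃ k ∈ c.support, k.1 = K) ∧ ∃ k ∈ c.support, k.1 = -K) ∧
      (∃ k ∈ c.support, k.2 = L) ∧ ∃ k ∈ c.support, k.2 = -L := by
  have hd1 := congrArg Prod.fst hdeg
  have hd2 := congrArg Prod.snd hdeg
  simp only [trigDegree] at hd1 hd2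
  have e1 : ∀ a : ℤ, ¬ ∀ k ∈ c.support, a ≤ k.1 ∧ k.1 < a + (2 * K : ℕ) := fun a ha => by
    have := Nat.sInf_le (s := {n : ℕ | ∃ a : ℤ, ∀ k ∈ c.support, a ≤ k.1 ∧ k.1 < a + n}) ⟨a, ha⟩
    omega
  have e2 : ∀ a : ℤ, ¬ ∀ k ∈ c.support, a ≤ k.2 ∧ k.2 < a + (2 * L : ℕ) := fun a ha => by
    have := Nat.sInf_le (s := {n : ℕ | ∃ a : ℤ, ∀ k ∈ c.support, a ≤ k.2 ∧ k.2 < a + n}) ⟨a, ha⟩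
    omega
  refine ⟨⟨?_, ?_⟩, ?_, ?_⟩ <;> by_contra! hne
  · refine e1 (-K) fun k hk => ?_
    have h1 := mem_freqBox.1 (hc hk)
    have h2 := hne k hk
    omega
  · refine e1 (-K + 1) fun k hk => ?_
    have h1 := mem_freqBox.1 (hc hk)
    have h2 := hne k hk
    omega
  · refine e2 (-L) fun k hk => ?_
    have h1 := mem_freqBox.1 (hc hk)
    have h2 := hne k hk
    omega
  · refine e2 (-L + 1) fun k hk => ?_
    have h1 := mem_freqBox.1 (hc hk)
    have h2 := hne k hk
    omega

theorem ContDiff.hasDerivAt_slice_snd {E : Type*} [NormedAddCommGroup E] [NormedSpace ℝ E]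
    {m : ℝ × ℝ → E} (hm : ContDiff ℝ 1 m) (x y : ℝ) :
    HasDerivAt (fun y => m (x, y)) (fderiv ℝ m (x, y) (0, 1)) y :=
  ((hm.differentiable (by norm_num)) (x, y)).hasFDerivAt.comp_hasDerivAt y
    ((hasDerivAt_const y x).prodMk (hasDerivAt_id y))

section Bivariate

open Polynomial

theorem coeff_toBivariate_toNat {K L : ℕ} {c : ℤ × ℤ →₀ ℂ} (hc : c.support ⊆ freqBox K L)
    {k : ℤ × ℤ} (hk : k ∈ freqBox K L) :
    ((toBivariate K L c).coeff (k.2 + L).toNat).coeff (k.1 + K).toNat = c k := by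
  rw [coeff_toBivariate hc]
  congr 1
  have := mem_freqBox.1 hk
  ext <;> simp only <;> omega

theorem not_C_X_dvd_toBivariate {K L : ℕ} {c : ℤ × ℤ →₀ ℂ} (hc : c.support ⊆ freqBox K L)
    (hdeg : trigDegree c = (2 * K + 1, 2 * L + 1)) : ¬ C X ∣ toBivariate K L c := by
  obtain ⟨k, hk, hk1⟩ := (exists_mem_support_eq_of_trigDegree hc hdeg).1.2
  rw [C_dvd_iff_dvd_coeff]
  intro h
  have h1 := X_dvd_iff.1 (h (k.2 + L).toNat)
  have h2 := coeff_toBivariate_toNat hc (hc hk)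
  rw [hk1, neg_add_cancel, Int.toNat_zero, h1] at h2
  exact Finsupp.mem_support_iff.1 hk h2.symm

theorem not_X_dvd_toBivariate {K L : ℕ} {c : ℤ × ℤ →₀ ℂ} (hc : c.support ⊆ freqBox K L)
    (hdeg : trigDegree c = (2 * K + 1, 2 * L + 1)) : ¬ X ∣ toBivariate K L c := by
  obtain ⟨k, hk, hk1⟩ := (exists_mem_support_eq_of_trigDegree hc hdeg).2.2
  intro h
  have h1 := X_dvd_iff.1 h
  have h2 := coeff_toBivariate_toNat hc (hc hk)
  rw [hk1, neg_add_cancel, Int.toNat_zero, h1] at h2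
  exact Finsupp.mem_support_iff.1 hk h2.symm

theorem prime_C_X : Prime (C X : ℂ[X][X]) := prime_C_iff.2 prime_X

/-- Divisibility up to monomials within a fixed box is proportionality. -/
theorem exists_eq_smul_of_toBivariate_dvd {K L : ℕ} {c d : ℤ × ℤ →₀ ℂ}
    (hc : c.support ⊆ freqBox K L) (hdeg : trigDegree c = (2 * K + 1, 2 * L + 1))
    (hd : d.support ⊆ freqBox K L) {M N : ℕ}
    (h : toBivariate K L c ∣ C X ^ M * X ^ N * toBivariate K L d) : ∃ a : ℂ, d = a • c := by
  have hdvd : toBivariate K L c ∣ toBivariate K L d := by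
    obtain ⟨G, hG⟩ := h
    -- Both variables are primes not dividing the polynomial of `c`, so the monomial must divide the
    -- cofactor and cancels.
    obtain ⟨G₁, rfl⟩ := prime_C_X.pow_dvd_of_dvd_mul_left M (not_C_X_dvd_toBivariate hc hdeg)
      (⟨_, by rw [← hG, mul_assoc]⟩ : C X ^ M ∣ toBivariate K L c * G)
    have hG1 : X ^ N * toBivariate K L d = toBivariate K L c * G₁ := by
      apply mul_left_cancel₀ (pow_ne_zero M prime_C_X.ne_zero)
      linear_combination hG
    obtain ⟨G₂, rfl⟩ := prime_X.pow_dvd_of_dvd_mul_left N (not_X_dvd_toBivariate hc hdeg)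
      (⟨_, hG1.symm⟩ : X ^ N ∣ toBivariate K L c * G₁)
    refine ⟨G₂, ?_⟩
    apply mul_left_cancel₀ (pow_ne_zero N (prime_X (R := ℂ[X])).ne_zero)
    linear_combination hG1
  obtain ⟨G, hG⟩ := hdvd
  obtain ⟨⟨⟨k₁, hk₁, hk₁'⟩, -⟩, ⟨k₂, hk₂, hk₂'⟩, -⟩ := exists_mem_support_eq_of_trigDegree hc hdeg
  -- The polynomial of `c` has degree at least 2L in the outer variable and that of `d` at most 2L,
  -- so `G` is constant there. The same comparison with 2K, on one row of coefficients, settles the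
  -- inner variable.
  have hconst : ∃ z : ℂ, G = C (C z) := by
    by_cases hG0 : G = 0
    · exact ⟨0, by simp [hG0]⟩
    have hcne := coeff_toBivariate_toNat hc (hc hk₂)
    have hlo : (k₂.2 + L).toNat ≤ (toBivariate K L c).natDegree := by
      refine le_natDegree_of_ne_zero fun h0 => ?_
      rw [h0, coeff_zero] at hcne
      exact Finsupp.mem_support_iff.1 hk₂ hcne.symm
    have hup : (toBivariate K L d).natDegree ≤ 2 * L := by
      rw [natDegree_le_iff_coeff_eq_zero]
      intro j hj
      ext i
      rw [coeff_toBivariate hd, coeff_zero]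
      refine Finsupp.notMem_support_iff.1 fun hmem => ?_
      have := mem_freqBox.1 (hd hmem)
      simp only at this
      omega
    have hc0 : toBivariate K L c ≠ 0 := fun h0 => by
      rw [h0, coeff_zero, coeff_zero] at hcne
      exact Finsupp.mem_support_iff.1 hk₂ hcne.symm
    rw [hG, natDegree_mul hc0 hG0] at hup
    obtain ⟨g, rfl⟩ := natDegree_eq_zero.1 (show G.natDegree = 0 by omega)
    have hg0 : g ≠ 0 := fun h0 => hG0 (by simp [h0])
    have hcne' := coeff_toBivariate_toNat hc (hc hk₁)
    set f := (toBivariate K L c).coeff (k₁.2 + L).toNat with hf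
    have hlo' : (k₁.1 + K).toNat ≤ f.natDegree := by
      refine le_natDegree_of_ne_zero fun h0 => ?_
      rw [h0] at hcne'
      exact Finsupp.mem_support_iff.1 hk₁ hcne'.symm
    have hf0 : f ≠ 0 := fun h0 => by
      rw [h0, coeff_zero] at hcne'
      exact Finsupp.mem_support_iff.1 hk₁ hcne'.symm
    have hup' : ((toBivariate K L d).coeff (k₁.2 + L).toNat).natDegree ≤ 2 * K := by
      rw [natDegree_le_iff_coeff_eq_zero]
      intro i hi
      rw [coeff_toBivariate hd]
      refine Finsupp.notMem_support_iff.1 fun hmem => ?_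
      have := mem_freqBox.1 (hd hmem)
      simp only at this
      omega
    rw [hG, coeff_mul_C, natDegree_mul hf0 hg0] at hup'
    obtain ⟨z, rfl⟩ := natDegree_eq_zero.1 (show g.natDegree = 0 by omega)
    exact ⟨z, rfl⟩
  obtain ⟨z, rfl⟩ := hconst
  refine ⟨z, Finsupp.ext fun k => ?_⟩
  by_cases hk : k ∈ freqBox K L
  · rw [← coeff_toBivariate_toNat hd hk, hG, coeff_mul_C, coeff_mul_C,
      coeff_toBivariate_toNat hc hk, Finsupp.smul_apply, smul_eq_mul, mul_comm]
  · rw [Finsupp.smul_apply, Finsupp.notMem_support_iff.1 fun h => hk (hd h),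
      Finsupp.notMem_support_iff.1 fun h => hk (hc h), smul_zero]

/-! ### Minimality and prime factors -/

theorem continuous_evalEval_unitExp (p : ℂ[X][X]) :
    Continuous fun r : ℝ × ℝ => p.evalEval (unitExp r.1) (unitExp r.2) := by
  obtain ⟨b, hb⟩ := exists_trigEval_eq_evalEval p
  rw [← funext hb]
  exact (contDiff_trigEval (n := 0) b).continuous

theorem hasDerivAt_eval_unitExp (f : ℂ[X]) (y : ℝ) :
    HasDerivAt (fun y => f.eval (unitExp y))
      (f.derivative.eval (unitExp y) * (2 * Real.pi * Complex.I * unitExp y)) y :=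
  (f.hasDerivAt (unitExp y)).comp y (hasDerivAt_unitExp y)

theorem hasDerivAt_evalEval_unitExp (p : ℂ[X][X]) (u : ℂ) (y : ℝ) :
    HasDerivAt (fun y => p.evalEval u (unitExp y))
      (p.derivative.evalEval u (unitExp y) * (2 * Real.pi * Complex.I * unitExp y)) y := by
  have := hasDerivAt_eval_unitExp (p.map (evalRingHom u)) y
  simpa only [derivative_map, map_evalRingHom_eval] using this

theorem HasDerivAt.mul_eq_zero_of_eq_zero {A f : ℝ → ℂ} {f' : ℂ} {y : ℝ}
    (hA : DifferentiableAt ℝ A y) (hf : HasDerivAt f f' y) (h0 : f y = 0)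
    (h : HasDerivAt (fun y => A y * f y) 0 y) : A y * f' = 0 := by
  have := (hA.hasDerivAt.mul hf).unique h
  simpa [h0] using this

theorem trigEval_eq_unitExp_mul {K L : ℕ} {c : ℤ × ℤ →₀ ℂ} (hc : c.support ⊆ freqBox K L)
    {p q : ℂ[X][X]} (hpq : toBivariate K L c = p * q) (r : ℝ × ℝ) :
    trigEval c r = unitExp (-(K * r.1 + L * r.2)) * q.evalEval (unitExp r.1) (unitExp r.2) *
      p.evalEval (unitExp r.1) (unitExp r.2) := by
  have h := evalEval_toBivariate hc r
  rw [hpq, evalEval_mul] at h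
  rw [mul_assoc, mul_comm (evalEval _ _ q), h, ← mul_assoc, ← unitExp_add]
  simp [unitExp]

/-- At a zero of `p` the product rule leaves only q · ∂p times a non-vanishing factor. The witness
is the derivative of `p` in a variable that occurs in it: non-zero in characteristic 0 and of
smaller degree, hence not divisible by `p`. -/
theorem Prime.exists_mul_not_dvd_of_fderiv {K L : ℕ} {c : ℤ × ℤ →₀ ℂ}
    (hc : c.support ⊆ freqBox K L) {p q : ℂ[X][X]} (hp : Prime p)
    (hpq : toBivariate K L c = p * q) :
    ∃ w : ℂ[X][X], ¬ p ∣ w ∧ ∃ v : ℝ × ℝ, (v = (1, 0) ∨ v = (0, 1)) ∧ ∀ r : ℝ × ℝ,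
      p.evalEval (unitExp r.1) (unitExp r.2) = 0 → fderiv ℝ (trigEval c) r v = 0 →
      q.evalEval (unitExp r.1) (unitExp r.2) * w.evalEval (unitExp r.1) (unitExp r.2) = 0 := by
  have hfac := fun r => trigEval_eq_unitExp_mul hc hpq r
  have hu : ∀ x : ℝ, (2 * Real.pi * Complex.I * unitExp x : ℂ) ≠ 0 := fun x =>
    mul_ne_zero Complex.two_pi_I_ne_zero (unitExp_ne_zero x)
  by_cases hd : p.natDegree = 0
  · obtain ⟨s, rfl⟩ := natDegree_eq_zero.1 hd
    have hs : Prime s := prime_C_iff.1 hp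
    refine ⟨C (derivative s), ?_, (1, 0), Or.inl rfl, ?_⟩
    · intro h
      have h1 : s ∣ derivative s := by simpa using (C_dvd_iff_dvd_coeff _ _).1 h 0
      have h2 : derivative s = 0 := by
        by_contra hne
        have hlt := natDegree_derivative_lt (p := s) fun h0 => hne (by
          rw [eq_C_of_natDegree_eq_zero h0, derivative_C])
        exact absurd (natDegree_le_of_dvd h1 hne) (by omega)
      obtain ⟨z, rfl⟩ := natDegree_eq_zero.1 (derivative_eq_zero.1 h2)
      exact hs.not_isUnit (isUnit_C.2 (isUnit_iff_ne_zero.2 fun h0 => hs.ne_zero (by simp [h0])))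
    · rintro ⟨x, y⟩ h0 hf
      have hder := (contDiff_trigEval (n := 1) c).hasDerivAt_slice_fst x y
      rw [hf] at hder
      simp only [hfac, evalEval_C] at hder h0
      have hA : DifferentiableAt ℝ (fun x => unitExp (-(K * x + L * y)) *
          q.evalEval (unitExp x) (unitExp y)) x := by
        have h1 : DifferentiableAt ℝ (fun x : ℝ => unitExp (-(K * x + L * y))) x :=
          ((contDiff_unitExp (n := 1)).comp (by fun_prop)).differentiable (by norm_num) x
        exact h1.mul (hasDerivAt_eval_unitExp _ x).differentiableAt
      have := HasDerivAt.mul_eq_zero_of_eq_zero hA (hasDerivAt_eval_unitExp s x) h0 hder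
      simp only [mul_eq_zero, unitExp_ne_zero, hu, or_false, false_or, evalEval_C] at this ⊢
      exact this
  · refine ⟨derivative p, ?_, (0, 1), Or.inr rfl, ?_⟩
    · intro h
      have hlt := natDegree_derivative_lt hd
      have hne : derivative p ≠ 0 := fun h0 => hd (derivative_eq_zero.1 h0)
      exact absurd (natDegree_le_of_dvd h hne) (by omega)
    · rintro ⟨x, y⟩ h0 hf
      have hder := (contDiff_trigEval (n := 1) c).hasDerivAt_slice_snd x y
      rw [hf] at hder
      simp only [hfac] at hder h0
      have hA : DifferentiableAt ℝ (fun y => unitExp (-(K * x + L * y)) *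
          q.evalEval (unitExp x) (unitExp y)) y := by
        have h1 : DifferentiableAt ℝ (fun y : ℝ => unitExp (-(K * x + L * y))) y :=
          ((contDiff_unitExp (n := 1)).comp (by fun_prop)).differentiable (by norm_num) y
        exact h1.mul (hasDerivAt_evalEval_unitExp q _ y).differentiableAt
      have := HasDerivAt.mul_eq_zero_of_eq_zero hA (hasDerivAt_evalEval_unitExp p _ y) h0 hder
      simp only [mul_eq_zero, unitExp_ne_zero, hu, or_false, false_or] at this ⊢
      exact this

theorem mem_iff_of_trigCurve_eq {K L : ℕ} {c : ℤ × ℤ →₀ ℂ} (hc : c.support ⊆ freqBox K L)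
    {S : Set (ℝ × ℝ)} (hS : trigCurve c = S) (r : ℝ × ℝ) :
    r ∈ S ↔ r ∈ Set.Icc (0 : ℝ × ℝ) 1 ∧
      (toBivariate K L c).evalEval (unitExp r.1) (unitExp r.2) = 0 := by
  rw [← hS, trigCurve, evalEval_toBivariate hc]
  simp [unitExp_ne_zero]

/-- If `q` vanishes on `S`, its zero set is exactly `S`, and minimality makes p q divide a monomial
times `q`. Then `p` divides a monomial, so it is one of the variables up to a unit, which the full
degree of `c` rules out. -/
theorem IsMinimalTrigPoly.not_dvd_of_mul_eq {K L : ℕ} {c : ℤ × ℤ →₀ ℂ} {S : Set (ℝ × ℝ)}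
    (hmin : IsMinimalTrigPoly c S) (hc : c.support ⊆ freqBox K L)
    (hdeg : trigDegree c = (2 * K + 1, 2 * L + 1)) {p q : ℂ[X][X]} (hp : Prime p)
    (hpq : toBivariate K L c = p * q)
    (hS : ∀ r ∈ S, q.evalEval (unitExp r.1) (unitExp r.2) = 0) : False := by
  have hX := not_X_dvd_toBivariate hc hdeg
  have hq0 : q ≠ 0 := by
    rintro rfl
    exact hX (by simp [hpq])
  obtain ⟨b, hb⟩ := exists_trigEval_eq_evalEval q
  have hbS : trigCurve b = S := by
    ext r
    simp only [trigCurve, Set.mem_ofPred_eq, hb]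
    refine ⟨fun h => (mem_iff_of_trigCurve_eq hc hmin.1 r).2 ⟨h.1, ?_⟩, fun h =>
      ⟨((mem_iff_of_trigCurve_eq hc hmin.1 r).1 h).1, hS r h⟩⟩
    rw [hpq, evalEval_mul, h.2, mul_zero]
  obtain ⟨M, N, hMN⟩ := (hmin.2 b hbS).2.exists_toBivariate_dvd hc (q := q)
    ⟨0, 0, fun r => by simp [hb, unitExp]⟩
  rw [hpq] at hMN
  rcases hp.dvd_or_dvd ((mul_dvd_mul_iff_right hq0).1 hMN) with h | h
  · refine not_C_X_dvd_toBivariate hc hdeg ?_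
    have := (hp.associated_of_dvd prime_C_X (hp.dvd_of_dvd_pow h)).dvd'
    exact hpq ▸ this.mul_right q
  · refine hX ?_
    have := (hp.associated_of_dvd prime_X (hp.dvd_of_dvd_pow h)).dvd'
    exact hpq ▸ this.mul_right q

theorem IsMinimalTrigPoly.exists_eq_smul_of_fderiv {K L : ℕ} {c d : ℤ × ℤ →₀ ℂ}
    {S : Set (ℝ × ℝ)} (hmin : IsMinimalTrigPoly c S) (hc : c.support ⊆ freqBox K L)
    (hdeg : trigDegree c = (2 * K + 1, 2 * L + 1)) (hd : d.support ⊆ freqBox K L)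
    (hS : ∀ r ∈ S, ∃ᶠ z in nhdsWithin r {r}ᶜ, z ∈ S)
    (h : ∀ v : ℝ × ℝ, (v = (1, 0) ∨ v = (0, 1)) → ∀ r ∈ S,
      trigEval d r = 0 ∨ fderiv ℝ (trigEval c) r v = 0) : ∃ a : ℂ, d = a • c := by
  have hP0 : toBivariate K L c ≠ 0 := fun h0 =>
    not_X_dvd_toBivariate hc hdeg (by rw [h0]; exact dvd_zero _)
  have hmem := mem_iff_of_trigCurve_eq hc hmin.1
  refine exists_eq_smul_of_toBivariate_dvd hc hdeg hd (M := 0) (N := 0) ?_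
  simp only [pow_zero, one_mul]
  refine dvd_of_squarefree_of_forall_prime _ hP0 ?_ ?_
  -- Dropping one copy of a repeated factor would not change the zero set.
  · rw [squarefree_iff_irreducible_sq_not_dvd_of_ne_zero hP0]
    rintro p hp ⟨q, hq⟩
    refine hmin.not_dvd_of_mul_eq hc hdeg (q := p * q)
      (UniqueFactorizationMonoid.irreducible_iff_prime.1 hp) (by rw [hq]; ring) ?_
    intro r hr
    have := ((hmem r).1 hr).2
    rw [hq] at this
    simpa using this
  · rintro p hp ⟨q, hq⟩
    by_contra hpd
    have hpq : ¬ p ∣ q := by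
      rintro ⟨t, rfl⟩
      refine hmin.not_dvd_of_mul_eq hc hdeg hp hq fun r hr => ?_
      have := ((hmem r).1 hr).2
      rw [hq] at this
      simpa using this
    obtain ⟨w, hw, v, hv, hvw⟩ := hp.exists_mul_not_dvd_of_fderiv hc hq
    -- This product vanishes at every point of `S` with p = 0, whichever alternative of `h` holds
    -- there.
    have hnd : ¬ p ∣ toBivariate K L d * (q * w) := fun h =>
      (hp.dvd_or_dvd h).elim hpd fun h => (hp.dvd_or_dvd h).elim hpq hw
    have hfin := finite_preimage_unitExp (hp.finite_setOf_common_zero hnd)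
    refine hmin.not_dvd_of_mul_eq hc hdeg hp hq fun r hr => ?_
    by_contra hqr
    have hev1 : ∀ᶠ z in nhdsWithin r {r}ᶜ, q.evalEval (unitExp z.1) (unitExp z.2) ≠ 0 :=
      ((continuous_evalEval_unitExp q).continuousAt.eventually_ne hqr).filter_mono
        nhdsWithin_le_nhds
    have hev2 : ∀ᶠ z in nhdsWithin r {r}ᶜ, z ∉ {r : ℝ × ℝ | r ∈ Set.Icc (0 : ℝ × ℝ) 1 ∧
        (unitExp r.1, unitExp r.2) ∈ {z : ℂ × ℂ | p.evalEval z.1 z.2 = 0 ∧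
          (toBivariate K L d * (q * w)).evalEval z.1 z.2 = 0}} := by
      rw [eventually_nhdsWithin_iff]
      have hcl := (hfin.sdiff (t := {r})).isClosed.isOpen_compl.mem_nhds (x := r) (by simp)
      filter_upwards [hcl] with z hz hzr hzmem
      exact hz ⟨hzmem, hzr⟩
    -- Near a point of `S` where q ≠ 0 there is another point of `S` with q ≠ 0, outside the finite
    -- set of common zeros. Yet p = 0 there, which puts it in that set.
    obtain ⟨z, hz, hz1, hz2⟩ := ((hS r hr).and_eventually (hev1.and hev2)).exists
    obtain ⟨hzI, hzP⟩ := (hmem z).1 hz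
    rw [hq, evalEval_mul, mul_eq_zero, or_iff_left hz1] at hzP
    refine hz2 ⟨hzI, hzP, ?_⟩
    simp only [evalEval_mul, evalEval_toBivariate hd]
    rcases h v hv z hz with h0 | h0
    · rw [h0, mul_zero, zero_mul]
    · rw [hvw z hzP h0, mul_zero]

end Bivariate

/-! ### The annihilation equations as integrals over Ω -/

theorem trigEval_smul (a : ℂ) (c : ℤ × ℤ →₀ ℂ) (r : ℝ × ℝ) :
    trigEval (a • c) r = a * trigEval c r := by
  rw [trigEval_eq_sum_of_subset (Finsupp.support_smul (b := a) (g := c)),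
    trigEval_eq_sum_of_subset (Finset.Subset.refl _), Finset.mul_sum]
  simp [mul_assoc]

theorem trigMono_add (k l : ℤ × ℤ) (r : ℝ × ℝ) :
    trigMono (k + l) r = trigMono k r * trigMono l r := by
  rw [trigMono, trigMono, trigMono, ← unitExp_add]
  push_cast [Prod.fst_add, Prod.snd_add]
  ring_nf

theorem conj_trigMono (k : ℤ × ℤ) (r : ℝ × ℝ) :
    (starRingEnd ℂ) (trigMono k r) = trigMono (-k) r := by
  rw [trigMono, trigMono, conj_unitExp]
  push_cast [Prod.fst_neg, Prod.snd_neg]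
  ring_nf

theorem expNeg_freq (m : ℤ × ℤ) : expNeg (freq m) = trigMono (-m) := by
  ext r
  rw [expNeg, freq, trigMono, unitExp]
  congr 1
  push_cast [Prod.fst_neg, Prod.snd_neg]
  ring

theorem fderiv_trigMono (k : ℤ × ℤ) (r v : ℝ × ℝ) :
    fderiv ℝ (trigMono k) r v =
      2 * Real.pi * Complex.I * (k.1 * v.1 + k.2 * v.2) * trigMono k r := by
  set A : ℝ × ℝ →L[ℝ] ℝ :=
    (k.1 : ℝ) • ContinuousLinearMap.fst ℝ ℝ ℝ + (k.2 : ℝ) • ContinuousLinearMap.snd ℝ ℝ ℝ with hA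
  have hAr : ∀ s, A s = k.1 * s.1 + k.2 * s.2 := fun s => by simp [hA]
  have h := (hasDerivAt_unitExp (A r)).hasFDerivAt.comp r A.hasFDerivAt
  have he : trigMono k = unitExp ∘ A := by
    ext s
    simp [trigMono, hAr]
  rw [he, h.fderiv]
  simp [hAr]
  ring

theorem freqBox_two_mul_sub_freqBox (K L : ℕ) :
    freqBox (2 * K) (2 * L) - freqBox K L = freqBox (3 * K) (3 * L) := by
  ext m
  rw [Finset.mem_sub]
  simp only [mem_freqBox]
  push_cast
  constructor
  · rintro ⟨l, hl, k, hk, rfl⟩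
    simp only [Prod.fst_sub, Prod.snd_sub]
    omega
  · intro hm
    -- Clamp `m` to the box 2Λ; the difference lies in Λ.
    refine ⟨(max (-(2 * K : ℤ)) (min (2 * K) m.1), max (-(2 * L : ℤ)) (min (2 * L) m.2)), ?_,
      (max (-(2 * K : ℤ)) (min (2 * K) m.1), max (-(2 * L : ℤ)) (min (2 * L) m.2)) - m, ?_, ?_⟩
    · simp only; omega
    · simp only [Prod.fst_sub, Prod.snd_sub]; omega
    · exact sub_sub_cancel _ _

theorem integral_charFn_mul {Ω : Set (ℝ × ℝ)} (hΩ : IsOpen Ω) (g : ℝ × ℝ → ℂ) :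
    ∫ r, charFn Ω r * g r = ∫ r in Ω, g r := by
  rw [← integral_indicator hΩ.measurableSet]
  congr 1
  ext r
  by_cases hr : r ∈ Ω <;> simp [charFn, hr]

theorem distDeriv_charFn {Ω : Set (ℝ × ℝ)} (hΩ : IsOpen Ω) (v : ℝ × ℝ) {φ : ℝ × ℝ → ℂ}
    (hφ : Differentiable ℝ φ) :
    distDeriv (charFn Ω) v φ = -∫ r in Ω, fderiv ℝ φ r v := by
  rw [distDeriv, integral_charFn_mul hΩ]
  simp only [(hφ _).lineDeriv_eq_fderiv]

theorem differentiable_trigMono (k : ℤ × ℤ) : Differentiable ℝ (trigMono k) :=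
  (contDiff_trigMono (n := 1) k).differentiable (by norm_num)

theorem distDeriv_charFn_expNeg_freq {Ω : Set (ℝ × ℝ)} (hΩ : IsOpen Ω) (v : ℝ × ℝ)
    (m : ℤ × ℤ) : distDeriv (charFn Ω) v (expNeg (freq m)) =
      Complex.I * (((freq m).1 : ℂ) * v.1 + ((freq m).2 : ℂ) * v.2) *
        fourierHat (charFn Ω) (freq m) := by
  rw [fourierHat, integral_charFn_mul hΩ, expNeg_freq,
    distDeriv_charFn hΩ v (differentiable_trigMono _), ← integral_const_mul, ← integral_neg]
  congr 1
  ext r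
  rw [fderiv_trigMono, freq]
  push_cast [Prod.fst_neg, Prod.snd_neg]
  ring

theorem setIntegral_fderiv_sum_mul {ι : Type*} {Ω : Set (ℝ × ℝ)}
    (hb : Bornology.IsBounded Ω) (v : ℝ × ℝ) (s : Finset ι) (a : ι → ℂ) {φ : ι → ℝ × ℝ → ℂ}
    (hφ : ∀ i ∈ s, ContDiff ℝ 1 (φ i)) :
    ∫ r in Ω, fderiv ℝ (fun r => ∑ i ∈ s, a i * φ i r) r v =
      ∑ i ∈ s, a i * ∫ r in Ω, fderiv ℝ (φ i) r v := by
  have hd : ∀ r, fderiv ℝ (fun r => ∑ i ∈ s, a i * φ i r) r v =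
      ∑ i ∈ s, a i * fderiv ℝ (φ i) r v := by
    intro r
    have h := HasFDerivAt.fun_sum fun i hi =>
      (((hφ i hi).differentiable (by norm_num)) r).hasFDerivAt.const_mul (a i)
    rw [h.fderiv]
    simp
  simp only [hd]
  rw [integral_finsetSum]
  · simp only [integral_const_mul]
  · intro i hi
    exact (continuous_const.mul (((hφ i hi).continuous_fderiv (by norm_num)).clm_apply
      continuous_const)).integrableOn_of_isBounded hb

/-- Convolving with `d` amounts to multiplying the test exponential by its trigonometric polynomial,
since ∑ d[k] e^{-j2π⟨l-k,r⟩} = ν(r) e^{-j2π⟨l,r⟩}. -/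
theorem sum_mul_distDeriv_charFn {Ω : Set (ℝ × ℝ)} (hΩ : IsOpen Ω)
    (hb : Bornology.IsBounded Ω) (v : ℝ × ℝ) {Λ : Finset (ℤ × ℤ)} {d : ℤ × ℤ →₀ ℂ}
    (hd : d.support ⊆ Λ) (l : ℤ × ℤ) :
    ∑ k ∈ Λ, d k * distDeriv (charFn Ω) v (expNeg (freq (l - k))) =
      -∫ r in Ω, fderiv ℝ (fun r => trigEval d r * trigMono (-l) r) r v := by
  have he : (fun r => trigEval d r * trigMono (-l) r) =
      fun r => ∑ k ∈ Λ, d k * trigMono (-(l - k)) r := by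
    ext r
    rw [trigEval_eq_sum_of_subset hd, Finset.sum_mul]
    refine Finset.sum_congr rfl fun k _ => ?_
    rw [mul_assoc, ← trigMono_add]
    congr 2
    abel
  rw [he, setIntegral_fderiv_sum_mul hb v Λ d fun k _ => contDiff_trigMono _,
    ← Finset.sum_neg_distrib]
  refine Finset.sum_congr rfl fun k _ => ?_
  rw [expNeg_freq, distDeriv_charFn hΩ v (differentiable_trigMono _), mul_neg]

theorem annihilates_charFn_iff {Ω : Set (ℝ × ℝ)} (hΩ : IsOpen Ω)
    (hb : Bornology.IsBounded Ω) {Λ Γ : Finset (ℤ × ℤ)} {d : ℤ × ℤ →₀ ℂ}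
    (hd : d.support ⊆ Λ) : Annihilates (charFn Ω) Λ Γ d ↔
      ∀ v : ℝ × ℝ, (v = (1, 0) ∨ v = (0, 1)) → ∀ l ∈ Γ,
        ∫ r in Ω, fderiv ℝ (fun r => trigEval d r * trigMono (-l) r) r v = 0 := by
  simp only [Annihilates, fourierHatDx, fourierHatDy, sum_mul_distDeriv_charFn hΩ hb _ hd,
    neg_eq_zero]
  constructor
  · rintro h v (rfl | rfl) l hl
    exacts [(h l hl).1, (h l hl).2]
  · exact fun h l hl => ⟨h _ (Or.inl rfl) l hl, h _ (Or.inr rfl) l hl⟩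

theorem isCoordinateDirection_of_eq {v : ℝ × ℝ} (hv : v = (1, 0) ∨ v = (0, 1)) :
    IsCoordinateDirection v := by
  rcases hv with rfl | rfl
  exacts [isCoordinateDirection_fst, isCoordinateDirection_snd]

theorem annihilates_charFn_of_frontier {Ω : Set (ℝ × ℝ)} (hΩ : IsOpen Ω)
    (hb : Bornology.IsBounded Ω) {Λ : Finset (ℤ × ℤ)} (Γ : Finset (ℤ × ℤ)) {c : ℤ × ℤ →₀ ℂ}
    (hc : c.support ⊆ Λ) (h0 : ∀ r ∈ frontier Ω, trigEval c r = 0) :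
    Annihilates (charFn Ω) Λ Γ c := by
  rw [annihilates_charFn_iff hΩ hb hc]
  intro v hv l _
  refine setIntegral_fderiv_eq_zero_of_frontier (isCoordinateDirection_of_eq hv) hΩ hb
    (by fun_prop) fun r hr => ?_
  rw [h0 r hr, zero_mul]

theorem neg_mem_freqBox {K L : ℕ} {k : ℤ × ℤ} (hk : k ∈ freqBox K L) : -k ∈ freqBox K L := by
  rw [mem_freqBox] at hk ⊢
  simp only [Prod.fst_neg, Prod.snd_neg]
  omega

theorem sub_mem_freqBox_two_mul {K L : ℕ} {k l : ℤ × ℤ} (hk : k ∈ freqBox K L)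
    (hl : l ∈ freqBox K L) : k - l ∈ freqBox (2 * K) (2 * L) := by
  rw [mem_freqBox] at hk hl ⊢
  simp only [Prod.fst_sub, Prod.snd_sub]
  omega

theorem exists_trigEval_eq_conj {K L : ℕ} {c : ℤ × ℤ →₀ ℂ} (hc : c.support ⊆ freqBox K L) :
    ∃ b : ℤ × ℤ →₀ ℂ, b.support ⊆ freqBox K L ∧
      ∀ r, trigEval b r = (starRingEnd ℂ) (trigEval c r) := by
  have hb : ((c.mapRange (starRingEnd ℂ) (map_zero _)).equivMapDomain
      (Equiv.neg (ℤ × ℤ))).support ⊆ freqBox K L := by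
    intro k hk
    have h : c (-k) ≠ 0 := by simpa using hk
    simpa using neg_mem_freqBox (hc (Finsupp.mem_support_iff.2 h))
  refine ⟨_, hb, fun r => ?_⟩
  rw [trigEval_eq_sum_of_subset hb, trigEval_eq_sum_of_subset hc, map_sum]
  refine Finset.sum_nbij' (fun k => -k) (fun k => -k) (fun k => neg_mem_freqBox)
    (fun k => neg_mem_freqBox) (fun k _ => neg_neg k) (fun k _ => neg_neg k) fun k _ => ?_
  rw [map_mul, conj_trigMono, neg_neg]
  simp

/-! ### Reality of the minimal polynomial, and uniqueness -/

/-- The conjugate has the same zeros and, the box being symmetric, the same frequency box;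
minimality and the box argument make it proportional. -/
theorem IsMinimalTrigPoly.exists_conj_trigEval_eq {K L : ℕ} {c : ℤ × ℤ →₀ ℂ}
    {S : Set (ℝ × ℝ)} (hmin : IsMinimalTrigPoly c S) (hc : c.support ⊆ freqBox K L)
    (hdeg : trigDegree c = (2 * K + 1, 2 * L + 1)) :
    ∃ γ : ℂ, ∀ r, (starRingEnd ℂ) (trigEval c r) = γ * trigEval c r := by
  obtain ⟨b, hbs, hb⟩ := exists_trigEval_eq_conj hc
  have hbS : trigCurve b = S := by
    rw [← hmin.1]
    ext r
    simp [trigCurve, hb]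
  obtain ⟨M, N, hMN⟩ := (hmin.2 b hbS).2.exists_toBivariate_dvd hc
    ⟨K, L, evalEval_toBivariate hbs⟩
  obtain ⟨γ, rfl⟩ := exists_eq_smul_of_toBivariate_dvd hc hdeg hbs hMN
  exact ⟨γ, fun r => by rw [← hb, trigEval_smul]⟩

theorem fderiv_ofReal_comp {f : ℝ × ℝ → ℝ} (hf : Differentiable ℝ f) (r v : ℝ × ℝ) :
    fderiv ℝ (fun r => (f r : ℂ)) r v = fderiv ℝ f r v := by
  have := Complex.ofRealCLM.hasFDerivAt.comp r (hf r).hasFDerivAt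
  rw [show (fun r => (f r : ℂ)) = Complex.ofRealCLM ∘ f from rfl, this.fderiv]
  rfl

theorem fderiv_trigEval_eq_sum {c : ℤ × ℤ →₀ ℂ} {Λ : Finset (ℤ × ℤ)} (hc : c.support ⊆ Λ)
    (r v : ℝ × ℝ) : fderiv ℝ (trigEval c) r v =
      ∑ k ∈ Λ, c k * (2 * Real.pi * Complex.I * (k.1 * v.1 + k.2 * v.2)) * trigMono k r := by
  rw [funext (trigEval_eq_sum_of_subset hc)]
  have h := HasFDerivAt.fun_sum (u := Λ) fun k _ =>
    ((differentiable_trigMono k) r).hasFDerivAt.const_mul (c k)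
  rw [h.fderiv]
  simp [fderiv_trigMono, mul_assoc]

/-- This is where equations on 2Λ are needed: the frequencies of ν̄ ∂ᵥμ are differences of two
elements of Λ. -/
theorem setIntegral_fderiv_normSq_mul_eq_zero {Ω : Set (ℝ × ℝ)}
    (hb : Bornology.IsBounded Ω) {K L : ℕ} {c d : ℤ × ℤ →₀ ℂ}
    (hc : c.support ⊆ freqBox K L) (hd : d.support ⊆ freqBox K L) (v : ℝ × ℝ)
    (h : ∀ l ∈ freqBox (2 * K) (2 * L),
      ∫ r in Ω, fderiv ℝ (fun r => trigEval d r * trigMono (-l) r) r v = 0) (z : ℂ) :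
    ∫ r in Ω, fderiv ℝ (fun r => trigEval d r * (starRingEnd ℂ) (trigEval d r) *
      (z * fderiv ℝ (trigEval c) r v)) r v = 0 := by
  have he : (fun r => trigEval d r * (starRingEnd ℂ) (trigEval d r) *
      (z * fderiv ℝ (trigEval c) r v)) = fun r => ∑ i ∈ freqBox K L ×ˢ freqBox K L,
        ((starRingEnd ℂ) (d i.1) * (z * (c i.2 *
          (2 * Real.pi * Complex.I * (i.2.1 * v.1 + i.2.2 * v.2))))) *
          (trigEval d r * trigMono (-(i.1 - i.2)) r) := by
    ext r
    have hconj : (starRingEnd ℂ) (trigEval d r) =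
        ∑ k ∈ freqBox K L, (starRingEnd ℂ) (d k) * trigMono (-k) r := by
      rw [trigEval_eq_sum_of_subset hd, map_sum]
      simp only [map_mul, conj_trigMono]
    rw [hconj, fderiv_trigEval_eq_sum hc, mul_assoc, Finset.mul_sum _ _ z, Finset.sum_mul_sum,
      ← Finset.sum_product', Finset.mul_sum]
    refine Finset.sum_congr rfl fun i _ => ?_
    rw [show -(i.1 - i.2) = -i.1 + i.2 by abel, trigMono_add]
    ring
  rw [he, setIntegral_fderiv_sum_mul hb v _ _ fun i _ => by fun_prop]
  refine Finset.sum_eq_zero fun i hi => ?_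
  rw [Finset.mem_product] at hi
  rw [h _ (sub_mem_freqBox_two_mul hi.1 hi.2), mul_zero]

theorem IsMinimalTrigPoly.trigEval_eq_zero_or_fderiv_eq_zero {Ω : Set (ℝ × ℝ)}
    (hΩ : IsOpen Ω) (hsq : Ω ⊆ Set.Icc (0 : ℝ × ℝ) 1) (hconn : IsConnected Ω) {K L : ℕ}
    {c d : ℤ × ℤ →₀ ℂ} (hc : c.support ⊆ freqBox K L)
    (hdeg : trigDegree c = (2 * K + 1, 2 * L + 1)) (hmin : IsMinimalTrigPoly c (frontier Ω))
    (hd : d.support ⊆ freqBox K L) {v : ℝ × ℝ} (hv : IsCoordinateDirection v)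
    (h : ∀ l ∈ freqBox (2 * K) (2 * L),
      ∫ r in Ω, fderiv ℝ (fun r => trigEval d r * trigMono (-l) r) r v = 0)
    {r : ℝ × ℝ} (hr : r ∈ frontier Ω) :
    trigEval d r = 0 ∨ fderiv ℝ (trigEval c) r v = 0 := by
  have hb : Bornology.IsBounded Ω := (Metric.isBounded_Icc _ _).subset hsq
  have hne : ∀ r ∈ Ω, trigEval c r ≠ 0 := by
    intro r hr h0
    have hf : r ∈ frontier Ω := hmin.1 ▸ (⟨hsq hr, h0⟩ : r ∈ trigCurve c)
    rw [hΩ.frontier_eq] at hf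
    exact hf.2 hr
  have hfr : ∀ r ∈ frontier Ω, trigEval c r = 0 := fun r hr => by
    rw [← hmin.1] at hr; exact hr.2
  obtain ⟨r₀, hr₀⟩ := hconn.nonempty
  obtain ⟨γ, hγ⟩ := hmin.exists_conj_trigEval_eq hc hdeg
  have hγ0 : γ ≠ 0 := by
    rintro rfl
    have := hγ r₀
    simp [hne r₀ hr₀] at this
  -- Normalising μ to be 1 at a point of `Ω` makes it real everywhere, as the factor γ cancels under
  -- conjugation; connectedness then fixes its sign.
  set z : ℂ := (trigEval c r₀)⁻¹ with hz
  have hz0 : z ≠ 0 := inv_ne_zero (hne r₀ hr₀)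
  set m : ℝ × ℝ → ℝ := fun r => (z * trigEval c r).re with hm
  have hmc : ∀ r, (m r : ℂ) = z * trigEval c r := by
    intro r
    refine Complex.conj_eq_iff_re.1 ?_
    rw [map_mul, hz, map_inv₀, hγ, hγ, mul_inv]
    field_simp
  have hmd : ContDiff ℝ 2 m :=
    Complex.reCLM.contDiff.comp (contDiff_const.mul (contDiff_trigEval c))
  have hmd1 : Differentiable ℝ m := hmd.differentiable (by norm_num)
  have hm0 : ∀ r ∈ Ω, m r ≠ 0 := fun r hr h0 => by
    have := hmc r
    rw [h0, Complex.ofReal_zero] at this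
    exact mul_ne_zero hz0 (hne r hr) this.symm
  have hmr₀ : m r₀ = 1 := by
    have := hmc r₀
    rw [hz, inv_mul_cancel₀ (hne r₀ hr₀)] at this
    exact_mod_cast this
  have hmpos : ∀ r ∈ Ω, 0 < m r := by
    intro r hr
    by_contra! hle
    obtain ⟨s, hs, hs0⟩ := hconn.isPreconnected.intermediate_value hr hr₀
      hmd.continuous.continuousOn (⟨hle, by rw [hmr₀]; exact zero_le_one⟩ : (0 : ℝ) ∈ Set.Icc (m r) (m r₀))
    exact hm0 s hs hs0
  have hfm : ∀ r, (fderiv ℝ m r v : ℂ) = z * fderiv ℝ (trigEval c) r v := by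
    intro r
    rw [← fderiv_ofReal_comp hmd1, funext hmc, fderiv_const_mul]
    · rfl
    · exact (contDiff_trigEval (n := 1) c).differentiable (by norm_num) r
  have hF : ContDiff ℝ 1 fun r => Complex.normSq (trigEval d r) := by
    have h1 : ContDiff ℝ 1 fun r => (trigEval d r).re :=
      Complex.reCLM.contDiff.comp (contDiff_trigEval d)
    have h2 : ContDiff ℝ 1 fun r => (trigEval d r).im :=
      Complex.imCLM.contDiff.comp (contDiff_trigEval d)
    exact (h1.mul h1).add (h2.mul h2)
  have hint : ∫ r in Ω, fderiv ℝ (fun r => Complex.normSq (trigEval d r) * fderiv ℝ m r v) r v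
      = 0 := by
    have hG : ContDiff ℝ 1 fun r => Complex.normSq (trigEval d r) * fderiv ℝ m r v :=
      hF.mul ((hmd.fderiv_right (m := 1) (by norm_num)).clm_apply contDiff_const)
    have h1 := setIntegral_fderiv_normSq_mul_eq_zero hb hc hd v h z
    simp only [Complex.mul_conj, ← hfm, ← Complex.ofReal_mul] at h1
    simp only [fderiv_ofReal_comp (hG.differentiable (by norm_num))] at h1
    exact_mod_cast h1
  rcases hv.eq_zero_or_fderiv_eq_zero hΩ hb hmd hF hmpos
    (fun r hr => by simp [hm, hfr r hr]) (fun r => Complex.normSq_nonneg _) hint hr with h0 | h0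
  · exact Or.inl (Complex.normSq_eq_zero.1 h0)
  · have := hfm r
    rw [h0, Complex.ofReal_zero] at this
    exact Or.inr ((mul_eq_zero.1 this.symm).resolve_left hz0)

theorem theorem1 (Ω : Set (ℝ × ℝ)) (hopen : IsOpen Ω) (hsq : Ω ⊆ Set.Icc (0 : ℝ × ℝ) 1)
    (hsc : IsSimplyConnected Ω) (K L : ℕ) (c : ℤ × ℤ →₀ ℂ)
    (hsupp : c.support ⊆ freqBox K L) (hdeg : trigDegree c = (2 * K + 1, 2 * L + 1))
    (hmin : IsMinimalTrigPoly c (frontier Ω)) :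
    -- the coefficients of the minimal polynomial are a non-trivial solution
    (c ≠ 0 ∧ Annihilates (charFn Ω) (freqBox K L) (freqBox (2 * K) (2 * L)) c) ∧
    -- every non-trivial solution is a non-zero multiple of them
    (∀ d : ℤ × ℤ →₀ ℂ, d.support ⊆ freqBox K L → d ≠ 0 →
      Annihilates (charFn Ω) (freqBox K L) (freqBox (2 * K) (2 * L)) d →
      ∃ a : ℂ, a ≠ 0 ∧ d = a • c) ∧
    -- the frequencies that occur are exactly those of the threefold dilation, and the data
    -- are obtained from the Fourier samples of the characteristic function there
    freqBox (2 * K) (2 * L) - freqBox K L = freqBox (3 * K) (3 * L) ∧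
    (∀ m ∈ freqBox (3 * K) (3 * L),
      fourierHatDx (charFn Ω) (freq m) =
        Complex.I * ((freq m).1 : ℂ) * fourierHat (charFn Ω) (freq m) ∧
      fourierHatDy (charFn Ω) (freq m) =
        Complex.I * ((freq m).2 : ℂ) * fourierHat (charFn Ω) (freq m)) := by
  have hb : Bornology.IsBounded Ω := (Metric.isBounded_Icc _ _).subset hsq
  refine ⟨⟨?_, annihilates_charFn_of_frontier hopen hb _ hsupp fun r hr => ?_⟩, ?_,
    freqBox_two_mul_sub_freqBox K L, fun m _ => ⟨?_, ?_⟩⟩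
  · rintro rfl
    obtain ⟨k, hk, -⟩ := (exists_mem_support_eq_of_trigDegree hsupp hdeg).1.1
    simp at hk
  · rw [← hmin.1] at hr
    exact hr.2
  · intro d hd hd0 hann
    rw [annihilates_charFn_iff hopen hb hd] at hann
    obtain ⟨a, rfl⟩ := hmin.exists_eq_smul_of_fderiv hsupp hdeg hd
      (fun r hr => hsc.frequently_mem_frontier hopen hr) fun v hv r hr =>
        hmin.trigEval_eq_zero_or_fderiv_eq_zero hopen hsq hsc.isPathConnected.isConnected hsupp
          hdeg hd (isCoordinateDirection_of_eq hv) (hann v hv) hr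
    exact ⟨a, fun h => hd0 (by rw [h, zero_smul]), rfl⟩
  · simp [fourierHatDx, distDeriv_charFn_expNeg_freq hopen]
  · simp [fourierHatDy, distDeriv_charFn_expNeg_freq hopen]
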